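/- Let $K$ be a field of characteristic zero, let $R=K[x_0,\dots,x_N]$ be the homogeneous coordinate ring of $\mathbb P^N=\mathbb P^N_K$, and let $1\le c\le N$ and $s\ge c$ be integers. Let $\mathcal H=\{H_1,\dots,H_s\}$ be a collection of $s$ mutually distinct hyperplanes in $\mathbb P^N$ such that the intersection of any $c+1$ of them has codimension $c+1$ (for $c=N$ this means that it is empty). Let $$P(c,\mathcal H)=\bigcup_{1\le i_1<\dots<i_c\le s}H_{i_1}\cap\dots\cap H_{i_c}$$ be the associated codimension $c$ pseudo-star configuration, and let $I\subset R$ be its vanishing ideal, i.e. the ideal generated by all homogeneous polynomials that vanish at every point of $P(c,\mathcal H)$. For $m\ge1$ let $$I^{(m)}=\bigcap_{P\in\operatorname{Ass}(R/I)}\left(I^mR_P\cap R\right)$$ be the $m$-th symbolic power of $I$, and let $\alpha(I)$ be the least $t$ such that $I$ contains a nonzero form of degree $t$. Call a noetherian ring Cohen–Macaulay if, for each of its localizations at prime ideals, the depth equals the Krull dimension. Then: 1. $\deg P(c,\mathcal H)=\binom{s}{c}$, where the degree is $d!$ times the leading coefficient of the Hilbert polynomial of $R/I$ and $d$ is the degree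 of that polynomial; 2. $P(c,\mathcal H)$ is arithmetically Cohen–Macaulay, i.e. $R/I$ is Cohen–Macaulay; 3. $R/I^{(m)}$ is Cohen–Macaulay for all $1\le m\le c$; 4. $\alpha(I)=s-c+1$, and every minimal homogeneous generating set of $I$ consists of forms of degree $s-c+1$. -/

import Mathlib

open scoped LinearAlgebra.Projectivization

noncomputable section

namespace PseudoStar

/-! ### Cohen-Macaulay rings -/

/-- The depth of a local ring: the supremum of the lengths of the regular sequences contained in
the maximal ideal. -/
def depth (A : Type*) [CommRing A] [IsLocalRing A] : ℕ∞ :=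
  ⨆ (rs : List A) (_ : RingTheory.Sequence.IsRegular A rs ∧
    ∀ r ∈ rs, r ∈ IsLocalRing.maximalIdeal A), (rs.length : ℕ∞)

/-- A local ring is Cohen-Macaulay if it is noetherian and its depth equals its Krull dimension. -/
def IsCMLocalRing (A : Type*) [CommRing A] [IsLocalRing A] : Prop :=
  IsNoetherianRing A ∧ (depth A : WithBot ℕ∞) = ringKrullDim A

/-- A ring is Cohen-Macaulay if it is noetherian and its local rings at all primes are
Cohen-Macaulay. -/
def IsCMRing (A : Type*) [CommRing A] : Prop :=
  IsNoetherianRing A ∧ ∀ p : PrimeSpectrum A, IsCMLocalRing (Localization.AtPrime p.asIdeal)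

/-! ### Symbolic powers -/

/-- The `m`-th symbolic power of `I`: the intersection of the contractions `I ^ m A_P ∩ A`
over the associated primes `P` of `A / I`. -/
def symbolicPower {A : Type*} [CommRing A] (I : Ideal A) (m : ℕ) : Ideal A :=
  ⨅ (P : PrimeSpectrum A) (_ : P.asIdeal ∈ associatedPrimes A (A ⧸ I)),
    ((I ^ m).map (algebraMap A (Localization.AtPrime P.asIdeal))).comap
      (algebraMap A (Localization.AtPrime P.asIdeal))

/-! ### Projective space and its homogeneous coordinate ring -/

/-- The set of `K`-points of the projective space `ℙ^N`. -/
abbrev ProjSpace (K : Type*) [Field K] (N : ℕ) : Type _ := ℙ K (Fin (N + 1) → K)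

/-- Linear subspaces (flats) of `ℙ^N`. -/
abbrev Flat (K : Type*) [Field K] (N : ℕ) : Type _ :=
  Projectivization.Subspace K (Fin (N + 1) → K)

/-- The homogeneous coordinate ring `K[x_0, …, x_N]` of `ℙ^N`. -/
abbrev CoordRing (K : Type*) [Field K] (N : ℕ) : Type _ := MvPolynomial (Fin (N + 1)) K

section

variable {K : Type*} [Field K] {N : ℕ}

/-- A flat has codimension `r` in `ℙ^N` if its cone has codimension `r` in `K^(N+1)`.
In particular the empty flat has codimension `N + 1`. -/
def HasCodim (L : Flat K N) (r : ℕ) : Prop :=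
  Module.finrank K L.submodule + r = N + 1

/-- A hyperplane is a flat of codimension one. -/
def IsHyperplane (L : Flat K N) : Prop := HasCodim L 1

/-- The vanishing ideal of a set of points of `ℙ^N`: the ideal generated by the
homogeneous polynomials that vanish at all of its points. -/
def vanishingIdeal (Z : Set (ProjSpace K N)) : Ideal (CoordRing K N) :=
  Ideal.span {f | (∃ d : ℕ, f.IsHomogeneous d) ∧
    ∀ (v : Fin (N + 1) → K) (hv : v ≠ 0),
      Projectivization.mk K v hv ∈ Z → MvPolynomial.eval v f = 0}

/-- The homogeneous component `I_t`, as a subspace of the space `R_t` of all forms of degree `t`. -/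
def gradedPiece (I : Ideal (CoordRing K N)) (t : ℕ) :
    Submodule K (MvPolynomial.homogeneousSubmodule (Fin (N + 1)) K t) :=
  (I.restrictScalars K).comap (MvPolynomial.homogeneousSubmodule (Fin (N + 1)) K t).subtype

/-- `α(I) = a`: the number `a` is the least `t` with `I_t ≠ 0`. -/
def HasInitialDegree (I : Ideal (CoordRing K N)) (a : ℕ) : Prop :=
  IsLeast {t : ℕ | gradedPiece I t ≠ ⊥} a

/-- The Hilbert function `t ↦ dim_K R_t / I_t` of `R / I`, for a homogeneous ideal `I`. -/
def hilbertFunction (I : Ideal (CoordRing K N)) (t : ℕ) : ℕ :=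
  Module.finrank K (MvPolynomial.homogeneousSubmodule (Fin (N + 1)) K t ⧸ gradedPiece I t)

/-- The closed subscheme of `ℙ^N` defined by the homogeneous ideal `I` has degree `e`:
if `P` is the Hilbert polynomial of `R / I` and `d` is its degree (the dimension of the
subscheme), then the leading coefficient of `P` is `e / d!`. -/
def HasDegree (I : Ideal (CoordRing K N)) (e : ℕ) : Prop :=
  ∃ P : Polynomial ℚ,
    (∀ᶠ t : ℕ in Filter.atTop, (hilbertFunction I t : ℚ) = P.eval (t : ℚ)) ∧
    P.leadingCoeff * (Nat.factorial P.natDegree : ℚ) = (e : ℚ)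

/-- `S` is a minimal homogeneous generating set of `I`: it consists of homogeneous elements,
it generates `I`, and no proper subset of it generates `I`. -/
def IsMinimalHomogeneousGenerators (I : Ideal (CoordRing K N)) (S : Set (CoordRing K N)) : Prop :=
  (∀ f ∈ S, ∃ d : ℕ, f.IsHomogeneous d) ∧ Ideal.span S = I ∧
    ∀ T : Set (CoordRing K N), T ⊂ S → Ideal.span T ≠ I

/-- The union of all intersections of `c` of the flats `H_1, …, H_s`. -/
def configuration {s : ℕ} (c : ℕ) (H : Fin s → Flat K N) : Set (ProjSpace K N) :=
  ⋃ (T : Finset (Fin s)) (_ : T.card = c), ((⨅ i ∈ T, H i : Flat K N) : Set (ProjSpace K N))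

end

end PseudoStar

end

/-! Let ℓ_i be linear forms cutting out the H_i and, for a set F of c indices, let I_F be the ideal
generated by the ℓ_i with i ∈ F. When s > c, any c + 1 of the ℓ_i are linearly independent. This
suffices for the ideals J_m = ⋂_F I_F^m to behave as if the ℓ_i were variables: J_m is generated by
products of the ℓ_i (`IsStarFamily.levelIdeal_eq_iInf`), and R/J_m has a finite filtration by ideals
generated by such products, with every factor isomorphic, up to a shift of degree, to some R/I_F
(`IsStarFamily.exists_cleanFiltration`). The filtration comes from a total order on the pairs (k,
F), where k bounds the order along I_F; `key` encodes it in one number.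

The conclusions are read off from this filtration. As K is infinite, some N - c + 1 linear forms θ_j
complete each family (ℓ_i), i ∈ F, to a basis (`exists_common_basis`), so T = K[θ] maps
isomorphically onto every R/I_F. Hence R/J_m is finite projective over T, and a finite flat algebra
over a regular ring is Cohen-Macaulay (`isCMRing_of_finite_of_flat`). For m = 1 each F gives exactly
one factor, so the degree is binom(s, c), and J_1 is generated by the products of s - c + 1 distinct
ℓ_i.

Finally I = J_1 (`IsStarFamily.vanishingIdeal_eq`), and I^(m) = J_m
(`IsStarFamily.symbolicPower_eq`) because I_F^m is primary and I agrees with I_F locally at I_F.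
When s = c the forms may be dependent, but the configuration is a linear space and a maximal
independent subfamily defines the same set. -/

open scoped LinearAlgebra.Projectivization

noncomputable section

namespace PseudoStar

open IsLocalRing RingTheory.Sequence
open scoped Pointwise

universe u

/-! ### Regular local rings: domains with a regular sequence of maximal length -/

section RegularLocal

variable (A : Type u) [CommRing A]

/-- Prime avoidance: otherwise the maximal ideal m lies in m², hence is zero by Nakayama, or in a
minimal prime. Both contradict positive dimension. -/
lemma exists_mem_maximalIdeal_notMem_sq_notMem_minimalPrimes [IsRegularLocalRing A] {n : ℕ}
    (hn : ringKrullDim A = (n + 1 : ℕ)) :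
    ∃ x ∈ maximalIdeal A, x ∉ maximalIdeal A ^ 2 ∧ ∀ p ∈ minimalPrimes A, x ∉ p := by
  classical
  by_contra! h
  have hfin : (minimalPrimes A).Finite := minimalPrimes.finite_of_isNoetherianRing A
  have hht : (maximalIdeal A).height = (n + 1 : ℕ) := by
    have := maximalIdeal_height_eq_ringKrullDim (R := A)
    rw [hn] at this
    exact_mod_cast this
  let s : Finset (Ideal A) := insert (maximalIdeal A ^ 2) hfin.toFinset
  have hsub : ((maximalIdeal A : Ideal A) : Set A) ⊆
      ⋃ i ∈ (↑s : Set (Ideal A)), (id i : Ideal A) := by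
    intro x hx
    by_cases hx2 : x ∈ maximalIdeal A ^ 2
    · exact Set.mem_biUnion (x := maximalIdeal A ^ 2) (by simp [s]) hx2
    · obtain ⟨p, hp, hxp⟩ := h x hx hx2
      exact Set.mem_biUnion (x := p) (by simp [s, hp]) hxp
  -- Prime avoidance tolerates two ideals that are not prime; m² fills both places.
  rw [Ideal.subset_union_prime (maximalIdeal A ^ 2) (maximalIdeal A ^ 2)] at hsub
  · obtain ⟨i, hi, hle⟩ := hsub
    rw [Finset.mem_insert, Set.Finite.mem_toFinset] at hi
    rcases hi with rfl | hi
    · have hbot : maximalIdeal A = ⊥ := by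
        apply Submodule.eq_bot_of_le_smul_of_le_jacobson_bot (maximalIdeal A) _
          (IsNoetherian.noetherian _) _ (maximalIdeal_le_jacobson _)
        simpa [pow_two] using hle
      rw [hbot, Ideal.height_bot] at hht
      exact absurd hht.symm (by norm_cast)
    · have hp : i.IsPrime := hi.1.1
      have hle' : maximalIdeal A = i := le_antisymm hle (le_maximalIdeal hp.ne_top)
      rw [hle', Ideal.height_eq_zero_iff.2 hi] at hht
      exact absurd hht.symm (by norm_cast)
  · intro i hi h1 _
    rw [Finset.mem_insert, Set.Finite.mem_toFinset] at hi
    exact (hi.resolve_left h1).1.1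

/-- Since x ∉ m², some coefficient of x in a minimal generating set is a unit, so the corresponding
generator becomes redundant modulo x. -/
lemma spanFinrank_maximalIdeal_quotient_le [IsLocalRing A] [IsNoetherianRing A] {n : ℕ}
    (hn : (maximalIdeal A).spanFinrank = n + 1) {x : A} (hx : x ∈ maximalIdeal A)
    (hx2 : x ∉ maximalIdeal A ^ 2) [IsLocalRing (A ⧸ Ideal.span {x})] :
    (maximalIdeal (A ⧸ Ideal.span {x})).spanFinrank ≤ n := by
  classical
  set m := maximalIdeal A
  have hfg : m.FG := IsNoetherian.noetherian _
  have hfin := Submodule.FG.finite_generators hfg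
  set G : Finset A := hfin.toFinset with hG
  have hGs : Ideal.span (G : Set A) = m := by
    rw [hG, Set.Finite.coe_toFinset]; exact Submodule.span_generators m
  have hGc : G.card = n + 1 := by
    rw [hG, ← Set.ncard_eq_toFinset_card _ hfin, Submodule.FG.generators_ncard hfg, hn]
  obtain ⟨f, hf⟩ := (Submodule.mem_span_finset (s := G) (M := A) (R := A) (x := x)).1
    (by change x ∈ Ideal.span (G : Set A); rwa [hGs])
  have hunit : ∃ y ∈ G, f y ∉ m := by
    by_contra! hall
    apply hx2
    rw [← hf.2]
    refine Ideal.sum_mem _ fun y hy => ?_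
    rw [pow_two]
    exact Ideal.mul_mem_mul (hall y hy) (hGs ▸ Ideal.subset_span hy)
  obtain ⟨y, hy, hfy⟩ := hunit
  have hu : IsUnit (f y) := by
    by_contra hcon; exact hfy ((mem_maximalIdeal _).2 hcon)
  have hmap : m.map (Ideal.Quotient.mk (Ideal.span {x})) =
      maximalIdeal (A ⧸ Ideal.span {x}) :=
    map_maximalIdeal_of_surjective _ Ideal.Quotient.mk_surjective
  have hspan : maximalIdeal (A ⧸ Ideal.span {x}) =
      Submodule.span _ ((G.erase y).image (Ideal.Quotient.mk (Ideal.span {x})) : Set _) := by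
    rw [← hmap, ← hGs, Ideal.map_span]
    apply le_antisymm
    · rw [Ideal.span_le]
      rintro _ ⟨z, hz, rfl⟩
      by_cases hzy : z = y
      · subst hzy
        have h0 : ∑ a ∈ G.erase z, Ideal.Quotient.mk (Ideal.span {x}) (f a • a) +
            Ideal.Quotient.mk (Ideal.span {x}) (f z • z) = 0 := by
          rw [Finset.sum_erase_add _ _ hy, ← map_sum, hf.2, Ideal.Quotient.eq_zero_iff_mem]
          exact Ideal.mem_span_singleton_self x
        have h1 : Ideal.Quotient.mk (Ideal.span {x}) z =
            Ideal.Quotient.mk (Ideal.span {x}) (↑hu.unit⁻¹) *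
              (- ∑ a ∈ G.erase z, Ideal.Quotient.mk (Ideal.span {x}) (f a • a)) := by
          rw [← eq_neg_iff_add_eq_zero.2 (by rw [add_comm]; exact h0 ), ← map_mul, smul_eq_mul,
            ← mul_assoc, IsUnit.val_inv_mul, one_mul]
        rw [SetLike.mem_coe, h1]
        refine Ideal.mul_mem_left _ _ (neg_mem (Ideal.sum_mem _ fun a ha => ?_))
        rw [smul_eq_mul, map_mul]
        exact Ideal.mul_mem_left _ _
          (Ideal.subset_span (by simpa using ⟨a, by simpa [and_comm] using ha, rfl⟩))
      · exact Ideal.subset_span (by simpa using ⟨z, ⟨hz, hzy⟩, rfl⟩)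
    · apply Ideal.span_mono
      rw [Finset.coe_image]
      exact Set.image_mono (by simp)
  rw [hspan]
  refine (Submodule.spanFinrank_span_le_ncard_of_finite (Finset.finite_toSet _)).trans ?_
  rw [Set.ncard_coe_finset]
  refine Finset.card_image_le.trans ?_
  rw [Finset.card_erase_of_mem hy, hGc]
  simp

/-- Induction through A/(x) with x ∈ m \ m². The two claims are proved together because the
regularity of x needs A to be a domain, and this in turn uses that A/(x) is one. -/
theorem isDomain_and_exists_isRegular_of_isRegularLocalRing (n : ℕ) :
    ∀ (A : Type u) [CommRing A] [IsRegularLocalRing A], ringKrullDim A = n →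
      IsDomain A ∧ ∃ rs : List A, IsRegular A rs ∧ (∀ r ∈ rs, r ∈ maximalIdeal A) ∧
        rs.length = n := by
  induction n with
  | zero =>
    intro A _ _ hA
    have h := (isRegularLocalRing_iff A).1 inferInstance
    rw [hA] at h
    have h0 : (maximalIdeal A).spanFinrank = 0 := by exact_mod_cast h
    rw [Submodule.spanFinrank_eq_zero_iff_eq_bot (IsNoetherian.noetherian _)] at h0
    have hf : IsField A := isField_iff_maximalIdeal_eq.2 h0
    exact ⟨hf.isDomain, [], IsRegular.nil A A, by simp, rfl⟩
  | succ n ih =>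
    intro A _ _ hA
    obtain ⟨x, hx, hx2, hxp⟩ := exists_mem_maximalIdeal_notMem_sq_notMem_minimalPrimes A hA
    have hreg := (isRegularLocalRing_iff A).1 inferInstance
    rw [hA] at hreg
    have hxne : Ideal.span {x} ≠ ⊤ := by
      rw [Ne, Ideal.span_singleton_eq_top]; exact hx
    have : Nontrivial (A ⧸ Ideal.span {x}) := Ideal.Quotient.nontrivial_iff.2 hxne
    have : IsLocalRing (A ⧸ Ideal.span {x}) :=
      IsLocalRing.of_surjective' _ Ideal.Quotient.mk_surjective
    have h1 := spanFinrank_maximalIdeal_quotient_le A (n := n) (by exact_mod_cast hreg) hx hx2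
    have h2 : ((n + 1 : ℕ) : WithBot ℕ∞) ≤ ringKrullDim (A ⧸ Ideal.span {x}) + 1 := by
      rw [← hA]
      have h := ringKrullDim_le_ringKrullDim_quotient_add_card {x}
        (by simpa [ringJacobson_eq_maximalIdeal] using hx)
      rwa [ringKrullDim_eq_of_ringEquiv (Ideal.quotEquivOfEq
        (congrArg Ideal.span (Finset.coe_singleton x))), Finset.card_singleton,
        Nat.cast_one] at h
    have h3 : (n : WithBot ℕ∞) ≤ ringKrullDim (A ⧸ Ideal.span {x}) := by
      rw [Nat.cast_add, Nat.cast_one] at h2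
      exact (WithBot.add_le_add_iff_right' WithBot.one_ne_bot
        (by exact WithBot.coe_injective.ne ENat.one_ne_top)).1 h2
    have hreg' : IsRegularLocalRing (A ⧸ Ideal.span {x}) :=
      .of_spanFinrank_maximalIdeal_le _ ((Nat.cast_le.2 h1).trans h3)
    have hdim : ringKrullDim (A ⧸ Ideal.span {x}) = n := by
      refine le_antisymm ?_ h3
      rw [← (isRegularLocalRing_iff _).1 hreg']
      exact_mod_cast h1
    obtain ⟨hdom, rs, hrs, hmem, hlen⟩ := ih (A ⧸ Ideal.span {x}) hdim
    have hprime : (Ideal.span {x}).IsPrime := (Ideal.Quotient.isDomain_iff_prime _).1 hdom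
    -- A minimal prime p inside the prime (x) does not contain x, so p = xp, and p = 0 by Nakayama.
    have hdomA : IsDomain A := by
      obtain ⟨p, hp, hple⟩ := Ideal.exists_minimalPrimes_le (I := (⊥ : Ideal A))
        (J := Ideal.span {x}) bot_le
      have hpp : p.IsPrime := hp.1.1
      have hbot : p = ⊥ := by
        apply Submodule.eq_bot_of_le_smul_of_le_jacobson_bot (maximalIdeal A) _
          (IsNoetherian.noetherian _) _ (maximalIdeal_le_jacobson _)
        intro z hz
        obtain ⟨w, rfl⟩ := Ideal.mem_span_singleton.1 (hple hz)
        exact Ideal.mul_mem_mul hx ((hpp.mem_or_mem hz).resolve_left (hxp p hp))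
      rw [hbot] at hpp
      exact IsDomain.of_bot_isPrime A
    refine ⟨hdomA, ?_⟩
    obtain ⟨rs, rfl⟩ := List.map_surjective_iff.2
      (Ideal.Quotient.mk_surjective (I := Ideal.span {x})) rs
    have hmem' : ∀ r ∈ x :: rs, r ∈ maximalIdeal A := by
      intro r hr
      rcases List.mem_cons.1 hr with rfl | hr
      · exact hx
      · have := hmem _ (List.mem_map_of_mem hr)
        rw [mem_maximalIdeal, mem_nonunits_iff] at this ⊢
        exact fun h => this (h.map _)
    refine ⟨x :: rs, IsRegular.of_isWeaklyRegular_of_mem_maximalIdeal A hmem' ?_, hmem', by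
      simpa using hlen⟩
    refine IsWeaklyRegular.cons ?_ ?_
    · have hx0 : x ≠ 0 := by rintro rfl; exact hx2 (zero_mem _)
      intro a b hab
      exact mul_left_cancel₀ hx0 hab
    · have h1 := (isWeaklyRegular_map_algebraMap_iff (M := A ⧸ Ideal.span {x})
        (A ⧸ Ideal.span {x}) rs).1 hrs.1
      have h : x • (⊤ : Submodule A A) = Ideal.span {x} := by
        rw [← Submodule.ideal_span_singleton_smul]; simp
      exact ((Submodule.quotEquivOfEq _ _ h).isWeaklyRegular_congr rs).2 h1

end RegularLocal

/-! ### Finite flat algebras over regular rings are Cohen-Macaulay -/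

section CohenMacaulay

lemma depth_le_ringKrullDim (A : Type*) [CommRing A] [IsLocalRing A] [IsNoetherianRing A] :
    (depth A : WithBot ℕ∞) ≤ ringKrullDim A := by
  obtain ⟨n, hn⟩ : ∃ n : ℕ∞, ringKrullDim A = n := ⟨_, (maximalIdeal_height_eq_ringKrullDim).symm⟩
  rw [hn]
  refine WithBot.coe_le_coe.2 (iSup₂_le fun rs hrs => ?_)
  have h := ringKrullDim_add_length_eq_ringKrullDim_of_isRegular rs hrs.1
  have hne : Ideal.ofList rs ≠ ⊤ := by
    intro h
    exact hrs.1.2 (by rw [h]; simp)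
  have : Nontrivial (A ⧸ Ideal.ofList rs) := Ideal.Quotient.nontrivial_iff.2 hne
  have h0 : (0 : WithBot ℕ∞) ≤ ringKrullDim (A ⧸ Ideal.ofList rs) :=
    ringKrullDim_nonneg_of_nontrivial
  have h1 : ((rs.length : ℕ) : WithBot ℕ∞) ≤ ringKrullDim A := by
    rw [← h]
    exact le_add_of_nonneg_left h0
  rw [hn] at h1
  exact_mod_cast h1

/-- Incomparability: a chain of primes in an integral extension contracts to a strict chain. -/
lemma height_le_height_comap_of_isIntegral {T A : Type*} [CommRing T] [CommRing A] [Algebra T A]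
    [Algebra.IsIntegral T A] (p : Ideal A) [hp : p.IsPrime] :
    p.height ≤ (p.comap (algebraMap T A)).height := by
  have := Order.height_le_height_apply_of_strictMono
    (PrimeSpectrum.comap (algebraMap T A)) (fun a b hab => by
      have : a.asIdeal < b.asIdeal := hab
      exact Ideal.IsIntegral.comap_lt_comap (R := T) this) ⟨p, hp⟩
  rwa [← PrimeSpectrum.height_eq_orderHeight, ← PrimeSpectrum.height_eq_orderHeight] at this

/-- A finite flat algebra over a regular ring is Cohen-Macaulay. -/
theorem isCMRing_of_finite_of_flat (T A : Type*) [CommRing T] [CommRing A] [Algebra T A]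
    [IsRegularRing T] [Module.Finite T A] [Module.Flat T A] : IsCMRing A := by
  have hA : IsNoetherianRing A := IsNoetherianRing.of_finite T A
  refine ⟨hA, fun P => ?_⟩
  set p := P.asIdeal
  set q := p.comap (algebraMap T A)
  have hnoeth : IsNoetherianRing (Localization.AtPrime p) :=
    IsLocalization.isNoetherianRing p.primeCompl _ hA
  refine ⟨hnoeth, le_antisymm (depth_le_ringKrullDim _) ?_⟩
  have hqh : q.height ≠ ⊤ := (Ideal.height_lt_top (Ideal.IsPrime.ne_top inferInstance)).ne
  obtain ⟨n, hn⟩ := ENat.ne_top_iff_exists.1 hqh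
  have hdim : ringKrullDim (Localization.AtPrime q) = n := by
    rw [IsLocalization.AtPrime.ringKrullDim_eq_height q, ← hn]; rfl
  -- A regular sequence of length ht q in T_q stays regular in A_p by flatness, and ht p ≤ ht q, so
  -- the depth of A_p reaches its dimension.
  obtain ⟨-, rs, hrs, hmem, hlen⟩ :=
    isDomain_and_exists_isRegular_of_isRegularLocalRing n (Localization.AtPrime q) hdim
  let f := Localization.localRingHom q p (algebraMap T A) rfl
  have hf : f.Flat := RingHom.Flat.localRingHom
    (f := algebraMap T A) (RingHom.flat_algebraMap_iff.2 inferInstance) p q rfl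
  let : Algebra (Localization.AtPrime q) (Localization.AtPrime p) := f.toAlgebra
  have : Module.Flat (Localization.AtPrime q) (Localization.AtPrime p) := hf
  have hloc : IsLocalHom f := Localization.isLocalHom_localRingHom q p _ rfl
  have hmem' : ∀ r ∈ rs.map (algebraMap (Localization.AtPrime q) (Localization.AtPrime p)),
      r ∈ maximalIdeal (Localization.AtPrime p) := by
    intro r hr
    obtain ⟨t, ht, rfl⟩ := List.mem_map.1 hr
    have ht := hmem t ht
    rw [mem_maximalIdeal, mem_nonunits_iff] at ht ⊢
    exact fun h => ht (hloc.map_nonunit _ h)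
  have hreg : IsRegular (Localization.AtPrime p)
      (rs.map (algebraMap (Localization.AtPrime q) (Localization.AtPrime p))) :=
    IsRegular.of_isWeaklyRegular_of_mem_maximalIdeal _ hmem' hrs.1.of_flat
  rw [IsLocalization.AtPrime.ringKrullDim_eq_height p]
  refine WithBot.coe_le_coe.2 ?_
  calc p.height ≤ q.height := height_le_height_comap_of_isIntegral p
    _ = n := hn.symm
    _ = ((rs.map (algebraMap (Localization.AtPrime q) (Localization.AtPrime p))).length : ℕ∞) := by
      simp [hlen]
    _ ≤ _ := le_iSup₂_of_le (f := fun rs (_ : IsRegular (Localization.AtPrime p) rs ∧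
        ∀ r ∈ rs, r ∈ maximalIdeal (Localization.AtPrime p)) => (rs.length : ℕ∞)) _
        ⟨hreg, hmem'⟩ le_rfl

end CohenMacaulay

end PseudoStar

end

open scoped LinearAlgebra.Projectivization

noncomputable section

namespace PseudoStar

/-! ### The filtration by products of the forms -/

section Filtration

open Finset

/-- A filtration of `R ⧸ I` with `n` cyclic factors `R ⧸ P`, `P ∈ Ps`, all of whose steps are
ideals generated by elements of `Gs`. -/
inductive CleanFiltration {R : Type*} [CommRing R] (Ps : Set (Ideal R)) (Gs : Set R) :
    ℕ → Ideal R → Prop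
  | top : CleanFiltration Ps Gs 0 ⊤
  | step {n : ℕ} {S : Set R} {u : R} {P : Ideal R} (hS : S ⊆ Gs) (hu : u ∈ Gs) (hP : P ∈ Ps)
      (hcolon : ∀ g, g * u ∈ Ideal.span S ↔ g ∈ P)
      (h : CleanFiltration Ps Gs n (Ideal.span (insert u S))) :
      CleanFiltration Ps Gs (n + 1) (Ideal.span S)

variable {R : Type*} [CommRing R] {s : ℕ} (ℓ : Fin s → R) (c : ℕ)

/-- The product of the powers `ℓ i ^ a i`. -/
def formMonomial (a : Fin s → ℕ) : R := ∏ i, ℓ i ^ a i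

/-- The ideal generated by the `ℓ i` with `i ∈ F`. -/
def formIdeal (F : Finset (Fin s)) : Ideal R := Ideal.span (ℓ '' F)

/-- The ideals generated by `c` of the `ℓ i`. -/
def formIdeals : Set (Ideal R) := {P | ∃ F : Finset (Fin s), F.card = c ∧ P = formIdeal ℓ F}

/-- The properties of a family of elements `ℓ i` that make the intersections of the powers of the
ideals generated by `c` of them behave as for variables of a polynomial ring. -/
structure IsStarFamily : Prop where
  isPrime : ∀ F : Finset (Fin s), F.card = c → (formIdeal ℓ F).IsPrime
  notMem : ∀ F : Finset (Fin s), F.card = c → ∀ j ∉ F, ℓ j ∉ formIdeal ℓ F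
  quasiRegular : ∀ F : Finset (Fin s), F.card = c → ∀ (k : ℕ) (g : (Fin s → ℕ) → R),
    ∑ b ∈ piAntidiag F k, g b * formMonomial ℓ b ∈ formIdeal ℓ F ^ (k + 1) →
      ∀ b ∈ piAntidiag F k, g b ∈ formIdeal ℓ F

/-- A numerical encoding of the pair `(∑ i ∈ F, a i, F)`. -/
def key (a : Fin s → ℕ) (F : Finset (Fin s)) : ℕ := ∑ i ∈ F, (a i * 2 ^ s + 2 ^ (i : ℕ))

/-- The ideal generated by the products of powers all of whose keys are at least `w`. -/
def levelIdeal (w : ℕ) : Ideal R :=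
  Ideal.span (formMonomial ℓ '' {a | ∀ F : Finset (Fin s), F.card = c → w ≤ key a F})

/-- The smallest exponent which agrees with `b` on `F` and whose key is minimal at `F`. -/
def minExp (F : Finset (Fin s)) (b : Fin s → ℕ) (j : Fin s) : ℕ :=
  if j ∈ F then b j else F.sup fun i => b i + if j < i then 1 else 0

variable {ℓ c}

lemma key_eq (a : Fin s → ℕ) (F : Finset (Fin s)) :
    key a F = (∑ i ∈ F, a i) * 2 ^ s + ∑ i ∈ F, 2 ^ (i : ℕ) := by
  rw [key, sum_add_distrib, sum_mul]

lemma sum_two_pow_lt (F : Finset (Fin s)) : ∑ i ∈ F, 2 ^ (i : ℕ) < 2 ^ s := by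
  have := Nat.geomSum_lt (m := 2) (n := s) (s := F.map Fin.valEmbedding) le_rfl (by simp)
  simpa using this

lemma sum_two_pow_injective {F F' : Finset (Fin s)}
    (h : ∑ i ∈ F, 2 ^ (i : ℕ) = ∑ i ∈ F', 2 ^ (i : ℕ)) : F = F' := by
  have : F.map Fin.valEmbedding = F'.map Fin.valEmbedding :=
    Finset.geomSum_injective (n := 2) le_rfl (by simpa using h)
  exact Finset.map_injective _ this

lemma le_of_mul_two_pow_le {x y r s : ℕ} (hr : r < 2 ^ s) (h : x * 2 ^ s ≤ y * 2 ^ s + r) :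
    x ≤ y := by
  by_contra! hlt
  have := Nat.mul_le_mul_right (2 ^ s) hlt
  rw [Nat.succ_mul] at this
  omega

lemma mul_two_pow_add_inj {x y r r' s : ℕ} (hr : r < 2 ^ s) (hr' : r' < 2 ^ s)
    (h : x * 2 ^ s + r = y * 2 ^ s + r') : x = y ∧ r = r' := by
  obtain rfl : x = y := le_antisymm (le_of_mul_two_pow_le hr' (h ▸ Nat.le_add_right _ _))
    (le_of_mul_two_pow_le hr (h ▸ Nat.le_add_right _ _))
  exact ⟨rfl, Nat.add_left_cancel h⟩

lemma key_mono {a a' : Fin s → ℕ} (h : a ≤ a') (F : Finset (Fin s)) : key a F ≤ key a' F :=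
  sum_le_sum fun i _ => by gcongr; exact h i

lemma key_le_key {a : Fin s → ℕ} {F F' : Finset (Fin s)} (hcard : F.card = F'.card)
    (h : ∀ i ∈ F, ∀ j ∉ F, a i * 2 ^ s + 2 ^ (i : ℕ) ≤ a j * 2 ^ s + 2 ^ (j : ℕ)) :
    key a F ≤ key a F' := by
  classical
  set v : Fin s → ℕ := fun i => a i * 2 ^ s + 2 ^ (i : ℕ)
  change ∑ i ∈ F, v i ≤ ∑ i ∈ F', v i
  rw [← sum_inter_add_sum_sdiff F F', ← sum_inter_add_sum_sdiff F' F, inter_comm F' F]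
  gcongr 1
  have hcard' : (F \ F').card = (F' \ F).card := card_sdiff_comm hcard
  calc ∑ i ∈ F \ F', v i ≤ (F \ F').card • ((F \ F').sup v) :=
        sum_le_card_nsmul _ _ _ fun i hi => le_sup (f := v) hi
    _ = (F' \ F).card • ((F \ F').sup v) := by rw [hcard']
    _ ≤ ∑ i ∈ F' \ F, v i := card_nsmul_le_sum _ _ _ fun j hj => by
        refine Finset.sup_le fun i hi => h i (mem_sdiff.1 hi).1 j (mem_sdiff.1 hj).2

lemma le_minExp {F : Finset (Fin s)} {b : Fin s → ℕ} {i j : Fin s} (hi : i ∈ F) (hj : j ∉ F) :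
    b i + (if j < i then 1 else 0) ≤ minExp F b j := by
  rw [minExp, if_neg hj]
  exact le_sup (f := fun i => b i + if j < i then 1 else 0) hi

lemma minExp_of_mem {F : Finset (Fin s)} {b : Fin s → ℕ} {i : Fin s} (hi : i ∈ F) :
    minExp F b i = b i := if_pos hi

/-- F minimizes the key as soon as no exchange of i ∈ F for j ∉ F lowers it. This asks for an
exponent at j of at least b i, and strictly more if j < i, since then 2 ^ j < 2 ^ i; hence the
summand 1 in `minExp`. -/
lemma key_minExp_le {F F' : Finset (Fin s)} (hcard : F.card = F'.card) (b : Fin s → ℕ) :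
    key (minExp F b) F ≤ key (minExp F b) F' := by
  refine key_le_key hcard fun i hi j hj => ?_
  have h := le_minExp (b := b) hi hj
  rw [minExp_of_mem hi]
  split_ifs at h with hji
  · have h1 : 2 ^ (i : ℕ) ≤ 2 ^ s := Nat.pow_le_pow_right (by norm_num) i.2.le
    have h2 := Nat.mul_le_mul_right (2 ^ s) h
    rw [Nat.succ_mul] at h2
    linarith [Nat.zero_le (2 ^ (j : ℕ))]
  · have h1 : 2 ^ (i : ℕ) ≤ 2 ^ (j : ℕ) :=
      Nat.pow_le_pow_right (by norm_num) (not_lt.1 hji)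
    have h2 := Nat.mul_le_mul_right (2 ^ s) h
    rw [add_zero] at h2
    omega

lemma key_minExp {F : Finset (Fin s)} {b : Fin s → ℕ} {k : ℕ} (hb : b ∈ piAntidiag F k) :
    key (minExp F b) F = k * 2 ^ s + ∑ i ∈ F, 2 ^ (i : ℕ) := by
  rw [key_eq, sum_congr rfl fun i hi => minExp_of_mem hi, (mem_piAntidiag.1 hb).1]

/-- The converse: minimality at F, tested on the sets obtained from F by exchanging one i for one j,
forces every inequality in the definition of `minExp`. -/
lemma minExp_le_of_forall_key_le {F : Finset (Fin s)} {a b : Fin s → ℕ}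
    (hab : ∀ i ∈ F, a i = b i)
    (h : ∀ F' : Finset (Fin s), F'.card = F.card → key a F ≤ key a F') : minExp F b ≤ a := by
  classical
  intro j
  rw [minExp]
  split_ifs with hj
  · exact (hab j hj).ge
  refine Finset.sup_le fun i hi => ?_
  rw [← hab i hi]
  have hlt : j ∉ F.erase i := fun h => hj (mem_of_mem_erase h)
  have h1 := h (insert j (F.erase i)) (by
    rw [card_insert_of_notMem hlt, card_erase_add_one hi])
  rw [key, key, sum_insert hlt, ← add_sum_erase F _ hi, add_le_add_iff_right] at h1
  have hi2 : 2 ^ (i : ℕ) < 2 ^ s := Nat.pow_lt_pow_right (by norm_num) i.2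
  have hj2 : 2 ^ (j : ℕ) < 2 ^ s := Nat.pow_lt_pow_right (by norm_num) j.2
  split_ifs with hji
  · have h2 : 2 ^ (j : ℕ) < 2 ^ (i : ℕ) := Nat.pow_lt_pow_right (by norm_num) hji
    have : a i * 2 ^ s < a j * 2 ^ s := by omega
    exact Nat.lt_of_mul_lt_mul_right this
  · rw [add_zero]
    exact le_of_mul_two_pow_le hj2 (by linarith [Nat.zero_le (2 ^ (i : ℕ))])

lemma formMonomial_add (a b : Fin s → ℕ) :
    formMonomial ℓ (a + b) = formMonomial ℓ a * formMonomial ℓ b := by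
  simp [formMonomial, pow_add, prod_mul_distrib]

lemma formMonomial_mem_pow (a : Fin s → ℕ) (F : Finset (Fin s)) :
    formMonomial ℓ a ∈ formIdeal ℓ F ^ (∑ i ∈ F, a i) := by
  rw [formMonomial, ← prod_mul_prod_compl F, ← Finset.prod_pow_eq_pow_sum]
  exact Ideal.mul_mem_right _ _ (Ideal.prod_mem_prod fun i hi =>
    Ideal.pow_mem_pow (Ideal.subset_span (Set.mem_image_of_mem ℓ hi)) _)

lemma formMonomial_mem_levelIdeal {a : Fin s → ℕ} {w : ℕ}
    (h : ∀ F : Finset (Fin s), F.card = c → w ≤ key a F) :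
    formMonomial ℓ a ∈ levelIdeal ℓ c w :=
  Ideal.subset_span ⟨a, h, rfl⟩

lemma levelIdeal_zero : levelIdeal ℓ c 0 = ⊤ := by
  rw [Ideal.eq_top_iff_one]
  have : formMonomial ℓ 0 ∈ levelIdeal ℓ c 0 := formMonomial_mem_levelIdeal (by simp)
  simpa [formMonomial] using this

lemma levelIdeal_anti {w w' : ℕ} (h : w ≤ w') : levelIdeal ℓ c w' ≤ levelIdeal ℓ c w :=
  Ideal.span_mono (Set.image_mono fun _ ha F hF => h.trans (ha F hF))

lemma levelIdeal_le_pow {w m : ℕ} {F : Finset (Fin s)} (hF : F.card = c)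
    (h : ∀ n, w ≤ n * 2 ^ s + ∑ i ∈ F, 2 ^ (i : ℕ) → m ≤ n) :
    levelIdeal ℓ c w ≤ formIdeal ℓ F ^ m := by
  refine Ideal.span_le.2 ?_
  rintro _ ⟨a, ha, rfl⟩
  have := ha F hF
  rw [key_eq] at this
  exact Ideal.pow_le_pow_right (h _ this) (formMonomial_mem_pow a F)

lemma levelIdeal_succ_le_pow {k : ℕ} {F : Finset (Fin s)} (hF : F.card = c) :
    levelIdeal ℓ c (k * 2 ^ s + ∑ i ∈ F, 2 ^ (i : ℕ) + 1) ≤ formIdeal ℓ F ^ (k + 1) := by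
  refine levelIdeal_le_pow hF fun n hn => ?_
  by_contra! hlt
  have := Nat.mul_le_mul_right (2 ^ s) (Nat.lt_succ_iff.1 hlt)
  omega

/-- A factor ℓ i with i ∈ F raises the key at F. The keys at all other sets are already larger: they
are no smaller, and equality is excluded because the residue modulo 2 ^ s determines the set. -/
lemma mul_formMonomial_minExp_mem {k : ℕ} {F : Finset (Fin s)} (hF : F.card = c)
    {b : Fin s → ℕ} (hb : b ∈ piAntidiag F k) {g : R} (hg : g ∈ formIdeal ℓ F) :
    g * formMonomial ℓ (minExp F b) ∈
      levelIdeal ℓ c (k * 2 ^ s + ∑ i ∈ F, 2 ^ (i : ℕ) + 1) := by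
  classical
  induction hg using Submodule.span_induction with
  | zero => simp
  | add x y _ _ hx hy => rw [add_mul]; exact add_mem hx hy
  | smul r x _ hx => rw [smul_eq_mul, mul_assoc]; exact Ideal.mul_mem_left _ _ hx
  | mem x hx =>
    obtain ⟨i, hi, rfl⟩ := hx
    have h1 : ℓ i * formMonomial ℓ (minExp F b) =
        formMonomial ℓ (Pi.single i 1 + minExp F b) := by
      rw [formMonomial_add]
      congr 1
      rw [formMonomial, Fintype.prod_eq_single i]
      · simp
      · intro j hj; simp [hj]
    rw [h1]
    refine formMonomial_mem_levelIdeal fun F' hF' => Nat.succ_le_of_lt ?_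
    have hle : k * 2 ^ s + ∑ i ∈ F, 2 ^ (i : ℕ) ≤ key (Pi.single i 1 + minExp F b) F' := by
      rw [← key_minExp hb]
      exact (key_minExp_le (hF.trans hF'.symm) b).trans (key_mono (by simp) _)
    refine lt_of_le_of_ne hle fun heq => ?_
    rw [key_eq] at heq
    obtain ⟨h2, h3⟩ := mul_two_pow_add_inj (sum_two_pow_lt F) (sum_two_pow_lt F') heq
    obtain rfl := sum_two_pow_injective h3
    simp only [Pi.add_apply, sum_add_distrib] at h2
    rw [sum_congr rfl fun i hi => minExp_of_mem hi, (mem_piAntidiag.1 hb).1,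
      sum_pi_single', if_pos (mem_coe.1 hi)] at h2
    omega

/-- An exponent leaving level w must have key w at F itself, as w determines k and F. It is then a
multiple of the `minExp` of its restriction to F. -/
lemma levelIdeal_eq {k : ℕ} {F : Finset (Fin s)} (hF : F.card = c) :
    levelIdeal ℓ c (k * 2 ^ s + ∑ i ∈ F, 2 ^ (i : ℕ)) =
      levelIdeal ℓ c (k * 2 ^ s + ∑ i ∈ F, 2 ^ (i : ℕ) + 1) ⊔
        Ideal.span ((fun b => formMonomial ℓ (minExp F b)) '' (piAntidiag F k : Set _)) := by
  classical
  apply le_antisymm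
  · refine Ideal.span_le.2 ?_
    rintro _ ⟨a, ha, rfl⟩
    by_cases h : ∀ F' : Finset (Fin s), F'.card = c →
        k * 2 ^ s + ∑ i ∈ F, 2 ^ (i : ℕ) + 1 ≤ key a F'
    · exact Ideal.mem_sup_left (formMonomial_mem_levelIdeal h)
    · push Not at h
      obtain ⟨F', hF', hlt⟩ := h
      have heq := le_antisymm (Nat.lt_succ_iff.1 hlt) (ha F' hF')
      have heq' := heq
      rw [key_eq] at heq
      obtain ⟨h2, h3⟩ := mul_two_pow_add_inj (sum_two_pow_lt F') (sum_two_pow_lt F) heq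
      obtain rfl := sum_two_pow_injective h3
      obtain ⟨b, hb⟩ : ∃ b : Fin s → ℕ, b = fun i => if i ∈ F' then a i else 0 := ⟨_, rfl⟩
      have hbF : b ∈ piAntidiag F' k := by
        rw [mem_piAntidiag]
        refine ⟨?_, fun i hi => ?_⟩
        · rw [← h2]; exact sum_congr rfl fun i hi => by simp [hb, hi]
        · by_contra hcon; simp [hb, hcon] at hi
      have hle : minExp F' b ≤ a := minExp_le_of_forall_key_le
        (fun i hi => by simp [hb, hi])
        (fun F'' hF'' => heq'.le.trans (ha F'' (hF''.trans hF)))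
      obtain ⟨d, rfl⟩ := exists_add_of_le hle
      rw [formMonomial_add]
      exact Ideal.mem_sup_right
            (Ideal.mul_mem_right _ _ (Ideal.subset_span (Set.mem_image_of_mem _ hbF)))
  · refine sup_le (levelIdeal_anti (Nat.le_succ _)) (Ideal.span_le.2 ?_)
    rintro _ ⟨b, hb, rfl⟩
    refine formMonomial_mem_levelIdeal fun F' hF' => ?_
    rw [← key_minExp hb]
    exact key_minExp_le (hF.trans hF'.symm) b

lemma levelIdeal_eq_succ {w : ℕ}
    (h : ∀ F : Finset (Fin s), F.card = c → ∀ k, w ≠ k * 2 ^ s + ∑ i ∈ F, 2 ^ (i : ℕ)) :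
    levelIdeal ℓ c w = levelIdeal ℓ c (w + 1) := by
  refine le_antisymm (Ideal.span_mono (Set.image_mono fun a ha F hF => ?_))
    (levelIdeal_anti (Nat.le_succ _))
  refine Nat.succ_le_of_lt (lt_of_le_of_ne (ha F hF) ?_)
  rw [key_eq]
  exact h F hF _

namespace IsStarFamily

variable (hℓ : IsStarFamily ℓ c)
include hℓ

lemma mem_of_mul_formMonomial_mem {F : Finset (Fin s)} (hF : F.card = c) {e : Fin s → ℕ}
    (he : ∀ i ∈ F, e i = 0) {g : R} (hg : g * formMonomial ℓ e ∈ formIdeal ℓ F) :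
    g ∈ formIdeal ℓ F := by
  have hp := hℓ.isPrime F hF
  refine (hp.mem_or_mem hg).resolve_right fun h => ?_
  obtain ⟨i, -, hi⟩ := hp.prod_mem_iff.1 h
  by_cases hiF : i ∈ F
  · rw [he i hiF, pow_zero] at hi
    exact hp.ne_top ((Ideal.eq_top_iff_one _).2 hi)
  · exact hℓ.notMem F hF i hiF (hp.mem_of_pow_mem _ hi)

/-- Outside F the exponent `minExp F b` contributes a product that is a nonzerodivisor modulo the
prime of F, so it can be absorbed in the coefficient and cancelled afterwards. -/
lemma quasiRegular_minExp {F : Finset (Fin s)} (hF : F.card = c) {k : ℕ}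
    {g : (Fin s → ℕ) → R}
    (h : ∑ b ∈ piAntidiag F k, g b * formMonomial ℓ (minExp F b) ∈ formIdeal ℓ F ^ (k + 1)) :
    ∀ b ∈ piAntidiag F k, g b ∈ formIdeal ℓ F := by
  classical
  set e : (Fin s → ℕ) → Fin s → ℕ := fun b j => if j ∈ F then 0 else minExp F b j with he
  have hsplit : ∀ b ∈ piAntidiag F k,
      formMonomial ℓ (minExp F b) = formMonomial ℓ (e b) * formMonomial ℓ b := by
    intro b hb
    rw [← formMonomial_add]
    congr 1
    ext j
    by_cases hj : j ∈ F
    · simp [he, hj, minExp_of_mem hj]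
    · have : b j = 0 := by
        by_contra hcon; exact hj ((mem_piAntidiag.1 hb).2 j hcon)
      simp [he, hj, this]
  intro b hb
  refine hℓ.mem_of_mul_formMonomial_mem hF (e := e b) (fun i hi => by simp [he, hi]) ?_
  refine hℓ.quasiRegular F hF k (fun b => g b * formMonomial ℓ (e b)) ?_ b hb
  convert! h using 1
  exact sum_congr rfl fun b hb => by rw [hsplit b hb, mul_assoc]

/-- One level of the filtration. -/
lemma cleanFiltration_level_succ {F : Finset (Fin s)} (hF : F.card = c) {k n : ℕ}
    (h : CleanFiltration (formIdeals ℓ c)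
      (Set.range (formMonomial ℓ)) n (levelIdeal ℓ c (k * 2 ^ s + ∑ i ∈ F, 2 ^ (i : ℕ)))) :
    CleanFiltration (formIdeals ℓ c)
      (Set.range (formMonomial ℓ)) (n + (piAntidiag F k).card)
      (levelIdeal ℓ c (k * 2 ^ s + ∑ i ∈ F, 2 ^ (i : ℕ) + 1)) := by
  classical
  set w := k * 2 ^ s + ∑ i ∈ F, 2 ^ (i : ℕ) with hw
  set G := formMonomial ℓ '' {a | ∀ F : Finset (Fin s), F.card = c → w + 1 ≤ key a F} with hG
  set u : (Fin s → ℕ) → R := fun b => formMonomial ℓ (minExp F b) with hu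
  -- D collects the generators already removed; dropping one more gives one step with factor R/I_F.
  suffices H : ∀ D : Finset (Fin s → ℕ), D ⊆ piAntidiag F k →
      CleanFiltration (formIdeals ℓ c)
      (Set.range (formMonomial ℓ)) (n + D.card)
      (Ideal.span (G ∪ u '' ((piAntidiag F k \ D : Finset _) : Set (Fin s → ℕ)))) by
    have := H _ Subset.rfl
    rwa [sdiff_self, bot_eq_empty, coe_empty, Set.image_empty, Set.union_empty] at this
  intro D
  induction D using Finset.induction_on with
  | empty =>
    intro _
    rw [hw, levelIdeal_eq hF] at h
    rw [card_empty, add_zero, sdiff_empty, Ideal.span_union]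
    exact h
  | insert b D hbD ih =>
    intro hsub
    have hb : b ∈ piAntidiag F k := hsub (mem_insert_self _ _)
    rw [card_insert_of_notMem hbD, ← add_assoc]
    refine CleanFiltration.step (u := u b) (P := formIdeal ℓ F) ?_ ⟨_, rfl⟩ ⟨F, hF, rfl⟩ ?_ ?_
    · rintro _ (⟨a, -, rfl⟩ | ⟨b, -, rfl⟩)
      exacts [⟨_, rfl⟩, ⟨_, rfl⟩]
    · intro g
      rw [Ideal.span_union]
      constructor
      · intro hg
        obtain ⟨x, hx, y, hy, hxy⟩ := Submodule.mem_sup.1 hg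
        obtain ⟨f, hf⟩ := (Submodule.mem_span_image_finset_iff_exists_fun' R).1 hy
        have hbn : b ∉ piAntidiag F k \ insert b D := by simp
        -- The relation g u_b = x + ∑ f_a u_a, rewritten with all u's on one side; coefficients of
        -- the other removed generators are 0, and g is the coefficient at b.
        have hsum : ∑ a ∈ piAntidiag F k, (if a = b then g else
            if a ∈ piAntidiag F k \ insert b D then - f a else 0) * u a = x := by
          rw [← add_sum_erase _ _ hb, if_pos rfl, ← hxy, ← hf]
          have : ∑ a ∈ (piAntidiag F k).erase b, (if a = b then g else
              if a ∈ piAntidiag F k \ insert b D then - f a else 0) * u a =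
              ∑ a ∈ piAntidiag F k \ insert b D, - (f a • u a) := by
            symm
            refine sum_subset_zero_on_sdiff ?_ ?_ ?_
            · intro a ha
              exact mem_erase.2 ⟨fun hab => hbn (hab ▸ ha), (mem_sdiff.1 ha).1⟩
            · intro a ha
              obtain ⟨h1, h2⟩ := mem_sdiff.1 ha
              rw [if_neg (ne_of_mem_erase h1), if_neg h2, zero_mul]
            · intro a ha
              rw [if_neg (ne_of_mem_of_not_mem ha hbn), if_pos ha, smul_eq_mul, neg_mul]
          rw [this, sum_neg_distrib]
          ring
        have := hℓ.quasiRegular_minExp hF (k := k) (hsum ▸ levelIdeal_succ_le_pow hF hx) b hb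
        simpa using this
      · intro hg
        exact Ideal.mem_sup_left (mul_formMonomial_minExp_mem hF hb hg)
    · have := ih ((subset_insert _ _).trans hsub)
      convert! this using 2
      rw [← Set.union_insert, ← Set.image_insert_eq, ← coe_insert]
      congr 3
      ext x
      simp only [mem_insert, mem_sdiff]
      by_cases hx : x = b
      · subst hx; simp [hb, hbD]
      · simp [hx]

/-- The number of cyclic factors below level `w`. -/
lemma exists_cleanFiltration_levelIdeal (w : ℕ) :
    ∃ n, CleanFiltration (formIdeals ℓ c) (Set.range (formMonomial ℓ)) n (levelIdeal ℓ c w) ∧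
      (w ≤ 2 ^ s → n = #{F ∈ powersetCard c (univ : Finset (Fin s)) |
        ∑ i ∈ (F : Finset (Fin s)), 2 ^ (i : ℕ) < w}) := by
  classical
  induction w with
  | zero =>
    refine ⟨0, ?_, by simp⟩
    rw [levelIdeal_zero]
    exact .top
  | succ w ih =>
    obtain ⟨n, hn, hcard⟩ := ih
    by_cases h : ∃ F : Finset (Fin s), F.card = c ∧ ∃ k, w = k * 2 ^ s + ∑ i ∈ F, 2 ^ (i : ℕ)
    · obtain ⟨F, hF, k, rfl⟩ := h
      refine ⟨_, hℓ.cleanFiltration_level_succ hF hn, fun hle => ?_⟩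
      -- Below 2 ^ s only k = 0 occurs, and then the single exponent 0 on F gives one factor per set
      -- F.
      obtain rfl : k = 0 := by
        by_contra hk
        have := Nat.mul_le_mul_right (2 ^ s) (Nat.one_le_iff_ne_zero.2 hk)
        omega
      rw [hcard (by omega), piAntidiag_zero, card_singleton]
      have : {F' ∈ powersetCard c (univ : Finset (Fin s)) |
          ∑ i ∈ (F' : Finset (Fin s)), 2 ^ (i : ℕ) < 0 * 2 ^ s + ∑ i ∈ F, 2 ^ (i : ℕ) + 1} =
          insert F {F' ∈ powersetCard c (univ : Finset (Fin s)) |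
          ∑ i ∈ (F' : Finset (Fin s)), 2 ^ (i : ℕ) < 0 * 2 ^ s + ∑ i ∈ F, 2 ^ (i : ℕ)} := by
        ext F'
        simp only [mem_filter, mem_powersetCard_univ, mem_insert, zero_mul, zero_add,
          Nat.lt_succ_iff]
        constructor
        · rintro ⟨h1, h2⟩
          rcases h2.eq_or_lt with h2 | h2
          · exact Or.inl (sum_two_pow_injective h2)
          · exact Or.inr ⟨h1, h2⟩
        · rintro (rfl | ⟨h1, h2⟩)
          exacts [⟨hF, le_rfl⟩, ⟨h1, h2.le⟩]
      rw [this, card_insert_of_notMem (by simp)]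
    · push Not at h
      refine ⟨n, by rwa [← levelIdeal_eq_succ fun F hF => h F hF], fun hle => ?_⟩
      rw [hcard (by omega)]
      congr 1
      refine filter_congr fun F hF => ?_
      have := h F (mem_powersetCard_univ.1 hF) 0
      omega

/-- For the harder inclusion an element of the intersection climbs level by level. At the level of
(k, F) with k < m, membership in I_F ^ (k + 1) puts the coefficients of the new generators in I_F by
quasi-regularity, which moves the element to the next level. -/
theorem levelIdeal_eq_iInf (m : ℕ) :
    levelIdeal ℓ c (m * 2 ^ s) = ⨅ (F : Finset (Fin s)) (_ : F.card = c), formIdeal ℓ F ^ m := by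
  classical
  apply le_antisymm
  · refine le_iInf₂ fun F hF => levelIdeal_le_pow hF fun n hn => ?_
    exact le_of_mul_two_pow_le (sum_two_pow_lt F) hn
  · intro g hg
    simp only [Ideal.mem_iInf] at hg
    suffices H : ∀ w ≤ m * 2 ^ s, g ∈ levelIdeal ℓ c w from H _ le_rfl
    intro w
    induction w with
    | zero => intro _; rw [levelIdeal_zero]; trivial
    | succ w ih =>
      intro hw
      have hgw := ih (by omega)
      by_cases h : ∃ F : Finset (Fin s), F.card = c ∧ ∃ k, w = k * 2 ^ s + ∑ i ∈ F, 2 ^ (i : ℕ)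
      · obtain ⟨F, hF, k, rfl⟩ := h
        rw [levelIdeal_eq hF] at hgw
        obtain ⟨x, hx, y, hy, rfl⟩ := Submodule.mem_sup.1 hgw
        refine add_mem hx ?_
        obtain ⟨f, rfl⟩ := (Submodule.mem_span_image_finset_iff_exists_fun' R).1 hy
        have hkm : k + 1 ≤ m := by
          by_contra! hlt
          have := Nat.mul_le_mul_right (2 ^ s) (Nat.lt_succ_iff.1 hlt)
          omega
        have h1 := Ideal.pow_le_pow_right hkm (hg F hF)
        have h0 : x ∈ formIdeal ℓ F ^ (k + 1) := levelIdeal_succ_le_pow hF hx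
        have h2 := (Ideal.add_mem_iff_right _ h0).1 h1
        have h3 := hℓ.quasiRegular_minExp hF h2
        exact Ideal.sum_mem _ fun b hb => mul_formMonomial_minExp_mem hF hb (h3 b hb)
      · push Not at h
        rwa [← levelIdeal_eq_succ fun F hF => h F hF]

theorem exists_cleanFiltration (m : ℕ) :
    ∃ n, CleanFiltration (formIdeals ℓ c) (Set.range (formMonomial ℓ)) n
      (⨅ (F : Finset (Fin s)) (_ : F.card = c), formIdeal ℓ F ^ m) := by
  obtain ⟨n, hn, -⟩ := hℓ.exists_cleanFiltration_levelIdeal (m * 2 ^ s)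
  exact ⟨n, hℓ.levelIdeal_eq_iInf m ▸ hn⟩

theorem cleanFiltration_choose :
    CleanFiltration (formIdeals ℓ c) (Set.range (formMonomial ℓ)) (s.choose c)
      (⨅ (F : Finset (Fin s)) (_ : F.card = c), formIdeal ℓ F) := by
  obtain ⟨n, hn, hcard⟩ := hℓ.exists_cleanFiltration_levelIdeal (1 * 2 ^ s)
  rw [hℓ.levelIdeal_eq_iInf 1] at hn
  simp only [pow_one] at hn
  rw [hcard (by simp), filter_true_of_mem fun F _ => by simpa using sum_two_pow_lt F,
    card_powersetCard, card_univ, Fintype.card_fin] at hn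
  exact hn

/-- Level 2 ^ s consists of the products whose support meets every set of c indices, that is, whose
support has at least s - c + 1 elements. -/
theorem iInf_formIdeal_eq_span (hc : c ≤ s) :
    (⨅ (F : Finset (Fin s)) (_ : F.card = c), formIdeal ℓ F) =
      Ideal.span ((fun D : Finset (Fin s) => ∏ i ∈ D, ℓ i) '' {D | D.card = s - c + 1}) := by
  classical
  apply le_antisymm
  · have h := hℓ.levelIdeal_eq_iInf 1
    simp only [pow_one] at h
    rw [← h]
    refine Ideal.span_le.2 ?_
    rintro _ ⟨a, ha, rfl⟩
    have hcard : s - c + 1 ≤ #{i | a i ≠ 0} := by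
      by_contra! hlt
      have h1 : #{i | a i ≠ 0} + #{i | ¬ a i ≠ 0} = s := by
        rw [card_filter_add_card_filter_not, card_univ, Fintype.card_fin]
      obtain ⟨F, hFsub, hF⟩ := exists_subset_card_eq (s := ({i | ¬ a i ≠ 0} : Finset (Fin s)))
        (n := c) (by omega)
      have h2 := ha F hF
      rw [key_eq, sum_eq_zero fun i hi => by simpa using hFsub hi] at h2
      have := sum_two_pow_lt F
      omega
    obtain ⟨D, hDsub, hD⟩ := exists_subset_card_eq hcard
    have hdvd : ∏ i ∈ D, ℓ i ∣ formMonomial ℓ a := by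
      rw [formMonomial, ← prod_mul_prod_compl D]
      refine Dvd.dvd.mul_right (prod_dvd_prod_of_dvd _ _ fun i hi => ?_) _
      exact dvd_pow_self _ (by simpa using hDsub hi)
    obtain ⟨r, hr⟩ := hdvd
    rw [SetLike.mem_coe, hr]
    exact Ideal.mul_mem_right _ _ (Ideal.subset_span ⟨D, hD, rfl⟩)
  · refine Ideal.span_le.2 ?_
    rintro _ ⟨D, hD, rfl⟩
    simp only [SetLike.mem_coe, Ideal.mem_iInf]
    intro F hF
    obtain ⟨i, hi⟩ : (D ∩ F).Nonempty := by
      rw [nonempty_iff_ne_empty, Ne, ← disjoint_iff_inter_eq_empty]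
      intro hdis
      have := card_union_of_disjoint hdis
      have h2 := card_le_univ (D ∪ F)
      rw [Fintype.card_fin] at h2
      have hD' : D.card = s - c + 1 := hD
      omega
    obtain ⟨h1, h2⟩ := mem_inter.1 hi
    exact Ideal.mem_of_dvd _ (dvd_prod_of_mem ℓ h1)
      (Ideal.subset_span (Set.mem_image_of_mem ℓ (mem_coe.2 h2)))

end IsStarFamily

end Filtration

end PseudoStar

end

open scoped LinearAlgebra.Projectivization

noncomputable section

namespace PseudoStar

/-! ### Linear forms and changes of coordinates -/

section Coordinates

open MvPolynomial Module

section SymmetricAlgebra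

variable {K W A : Type*} [Field K] [AddCommGroup W] [Module K W] [CommRing A] [Algebra K A]
  {ι ι' : Type*}

/-- The linear polynomial in the elements of a basis which corresponds to a vector. -/
def basisForm (b : Basis ι K W) : W →ₗ[K] MvPolynomial ι K := b.constr K X

@[simp]
lemma basisForm_self (b : Basis ι K W) (i : ι) : basisForm b (b i) = X i := b.constr_basis _ _ _

@[simp]
lemma aeval_basisForm (b : Basis ι K W) (f : W →ₗ[K] A) (w : W) :
    aeval (fun i => f (b i)) (basisForm b w) = f w := by
  have : (aeval (fun i => f (b i))).toLinearMap ∘ₗ basisForm b = f :=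
    b.ext fun i => by simp
  exact LinearMap.congr_fun this w

lemma isHomogeneous_constr (b : Basis ι K W) (v : ι → MvPolynomial ι' K)
    (hv : ∀ i, (v i).IsHomogeneous 1) (w : W) : (b.constr K v w).IsHomogeneous 1 := by
  have : LinearMap.range (b.constr K v) ≤ homogeneousSubmodule ι' K 1 := by
    rw [b.constr_range, Submodule.span_le]
    rintro _ ⟨i, rfl⟩
    exact hv i
  exact this ⟨w, rfl⟩

/-- The isomorphism of polynomial rings given by two bases of the space of linear forms. -/
def basisAlgEquiv (b : Basis ι K W) (b' : Basis ι' K W) :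
    MvPolynomial ι K ≃ₐ[K] MvPolynomial ι' K :=
  AlgEquiv.ofAlgHom (aeval fun i => basisForm b' (b i)) (aeval fun i => basisForm b (b' i))
    (algHom_ext fun i => by simp [-aeval_eq_bind₁]) (algHom_ext fun i => by simp [-aeval_eq_bind₁])

@[simp]
lemma basisAlgEquiv_X (b : Basis ι K W) (b' : Basis ι' K W) (i : ι) :
    basisAlgEquiv b b' (X i) = basisForm b' (b i) := by
  simp [basisAlgEquiv]

@[simp]
lemma basisAlgEquiv_C (b : Basis ι K W) (b' : Basis ι' K W) (a : K) :
    basisAlgEquiv b b' (C a) = C a :=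
  (basisAlgEquiv b b').commutes a

end SymmetricAlgebra

variable {K : Type*} [Field K] {N : ℕ}

variable (K N) in
/-- The coordinate functions, as a basis of the space of linear forms. -/
def coordBasis : Basis (Fin (N + 1)) K (Dual K (Fin (N + 1) → K)) :=
  (Pi.basisFun K (Fin (N + 1))).dualBasis

/-- A functional, as a linear form in the homogeneous coordinate ring. -/
def linearForm : Dual K (Fin (N + 1) → K) →ₗ[K] CoordRing K N := basisForm (coordBasis K N)

lemma isHomogeneous_linearForm (w : Dual K (Fin (N + 1) → K)) : (linearForm w).IsHomogeneous 1 :=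
  isHomogeneous_constr _ _ (fun i => isHomogeneous_X _ i) w

@[simp]
lemma eval_linearForm (v : Fin (N + 1) → K) (w : Dual K (Fin (N + 1) → K)) :
    eval v (linearForm w) = w v := by
  have h := aeval_basisForm (coordBasis K N) (Dual.eval K _ v) w
  rw [Dual.eval_apply] at h
  have hv : (fun i => Dual.eval K _ v (coordBasis K N i)) = v := by
    ext i
    simp [coordBasis]
  rw [hv] at h
  rw [← h, linearForm]
  rfl

lemma linearForm_injective : Function.Injective (linearForm (K := K) (N := N)) := by
  intro w w' h
  refine LinearMap.ext fun v => ?_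
  rw [← eval_linearForm v w, h, eval_linearForm]

/-- Evaluation of polynomials in the linear forms `θ j`. -/
def coordHom {d : ℕ} (θ : Fin d → Dual K (Fin (N + 1) → K)) :
    MvPolynomial (Fin d) K →ₐ[K] CoordRing K N :=
  aeval fun j => linearForm (θ j)

section Frame

variable {s d : ℕ} {F : Finset (Fin s)}
  (b : Basis (F ⊕ Fin d) K (Dual K (Fin (N + 1) → K)))

/-- The quotient map by the ideal of the first part of a basis of the linear forms. -/
def projHom : CoordRing K N →ₐ[K] MvPolynomial (Fin d) K :=
  aeval fun i => b.constr K (Sum.elim 0 X) (coordBasis K N i)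

@[simp]
lemma projHom_linearForm (w : Dual K (Fin (N + 1) → K)) :
    projHom b (linearForm w) = b.constr K (Sum.elim 0 X) w :=
  aeval_basisForm _ _ _

lemma projHom_coordHom {θ : Fin d → Dual K (Fin (N + 1) → K)} (hθ : ∀ j, b (.inr j) = θ j)
    (t : MvPolynomial (Fin d) K) : projHom b (coordHom θ t) = t := by
  have : (projHom b).comp (coordHom θ) = AlgHom.id K _ := algHom_ext fun j => by
    simp [coordHom, ← hθ]
  exact DFunLike.congr_fun this t

lemma isHomogeneous_projHom {f : CoordRing K N} {n : ℕ} (hf : f.IsHomogeneous n) :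
    (projHom b f).IsHomogeneous n := by
  have := hf.aeval (fun i => b.constr K (Sum.elim 0 X) (coordBasis K N i))
    (fun i => isHomogeneous_constr b _ (by
      rintro (i | j)
      exacts [isHomogeneous_zero _ _ _, isHomogeneous_X _ j]) _)
  rwa [one_mul] at this

lemma isHomogeneous_coordHom (θ : Fin d → Dual K (Fin (N + 1) → K))
    {t : MvPolynomial (Fin d) K} {n : ℕ} (ht : t.IsHomogeneous n) :
    (coordHom θ t).IsHomogeneous n := by
  have := ht.aeval (fun i => linearForm (θ i)) (fun i => isHomogeneous_linearForm _)
  rwa [one_mul] at this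

/-- The coordinate ring as a polynomial ring in the first part of a basis of the linear forms
over the polynomial ring in the second part. -/
def frameEquiv : MvPolynomial F (MvPolynomial (Fin d) K) ≃ₐ[K] CoordRing K N :=
  (sumAlgEquiv K F (Fin d)).symm.trans (basisAlgEquiv b (coordBasis K N))

@[simp]
lemma frameEquiv_X (i : F) : frameEquiv b (X i) = linearForm (b (.inl i)) := by
  simp [frameEquiv, linearForm]

lemma projHom_frameEquiv (g : MvPolynomial F (MvPolynomial (Fin d) K)) :
    projHom b (frameEquiv b g) = constantCoeff g := by
  have : ((projHom b).toRingHom.comp (frameEquiv b).toAlgHom.toRingHom) = constantCoeff := by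
    have hl : basisForm (coordBasis K N) = linearForm := rfl
    ext i
    · simp [frameEquiv, coeff_C]
    · simp [frameEquiv, hl]
    · simp
  exact DFunLike.congr_fun this g

variable {φ : Fin s → Dual K (Fin (N + 1) → K)} (hb : ∀ i : F, b (.inl i) = φ i)
include hb

lemma formIdeal_eq_map : formIdeal (fun i => linearForm (φ i)) F =
    (idealOfVars F (MvPolynomial (Fin d) K)).map (frameEquiv b) := by
  rw [formIdeal, idealOfVars, Ideal.map_span]
  congr 1
  ext x
  simp [hb]

lemma frameEquiv_mem_formIdeal_pow_iff (k : ℕ) (g : MvPolynomial F (MvPolynomial (Fin d) K)) :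
    frameEquiv b g ∈ formIdeal (fun i => linearForm (φ i)) F ^ k ↔
      g ∈ idealOfVars F (MvPolynomial (Fin d) K) ^ k := by
  rw [formIdeal_eq_map b hb, ← Ideal.map_pow, Ideal.mem_map_of_equiv]
  constructor
  · rintro ⟨x, hx, h⟩
    rwa [← (frameEquiv b).injective h]
  · exact fun h => ⟨g, h, rfl⟩

/-- In the coordinates of `frameEquiv`, `projHom` takes the constant coefficient and I_F is the
ideal of the variables. -/
lemma projHom_eq_zero_iff (f : CoordRing K N) :
    projHom b f = 0 ↔ f ∈ formIdeal (fun i => linearForm (φ i)) F := by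
  obtain ⟨g, rfl⟩ := (frameEquiv b).surjective f
  have := frameEquiv_mem_formIdeal_pow_iff b hb 1 g
  rw [pow_one, pow_one] at this
  rw [this, projHom_frameEquiv, ← pow_one (idealOfVars _ _), mem_pow_idealOfVars_iff']
  constructor
  · intro h x hx
    rw [Nat.lt_one_iff, Finsupp.degree_eq_zero_iff] at hx
    rw [hx]; exact h
  · intro h
    exact h 0 (by simp)

lemma formIdeal_eq_ker : formIdeal (fun i => linearForm (φ i)) F = RingHom.ker (projHom b) := by
  ext f
  rw [RingHom.mem_ker, projHom_eq_zero_iff b hb]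

lemma isPrime_formIdeal : (formIdeal (fun i => linearForm (φ i)) F).IsPrime := by
  rw [formIdeal_eq_ker b hb]
  exact RingHom.ker_isPrime _

lemma linearForm_mem_formIdeal_iff (w : Dual K (Fin (N + 1) → K)) :
    linearForm w ∈ formIdeal (fun i => linearForm (φ i)) F ↔
      w ∈ Submodule.span K (φ '' F) := by
  constructor
  · intro h
    -- A functional on the dual separating w from the span is evaluation at a point v; then I_F
    -- vanishes at v and w does not.
    by_contra hw
    obtain ⟨f, hf, hf'⟩ := Submodule.exists_dual_map_eq_bot_of_notMem hw inferInstance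
    obtain ⟨v, rfl⟩ := (evalEquiv K (Fin (N + 1) → K)).surjective f
    have hle : formIdeal (fun i => linearForm (φ i)) F ≤ RingHom.ker (eval v) := by
      refine Ideal.span_le.2 ?_
      rintro _ ⟨i, hi, rfl⟩
      rw [SetLike.mem_coe, RingHom.mem_ker, eval_linearForm]
      have := Submodule.mem_map_of_mem (f := (evalEquiv K (Fin (N + 1) → K) v))
        (Submodule.subset_span (R := K) (Set.mem_image_of_mem φ hi))
      rw [hf'] at this
      simpa using this
    have := hle h
    rw [RingHom.mem_ker, eval_linearForm] at this
    exact hf (by simpa using this)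
  · intro h
    rw [← projHom_eq_zero_iff b hb, projHom_linearForm]
    induction h using Submodule.span_induction with
    | mem x hx =>
      obtain ⟨i, hi, rfl⟩ := hx
      rw [← hb ⟨i, hi⟩, Basis.constr_basis]
      rfl
    | zero => rw [map_zero]
    | add x y _ _ hx hy => rw [map_add, hx, hy, add_zero]
    | smul a x _ hx => rw [map_smul, hx, smul_zero]

/-- After the change of coordinates the products of degree k are distinct monomials in the
variables, so the constant term of g a is the coefficient of its monomial in a sum of order at least
k + 1. -/
lemma quasiRegular_formIdeal (k : ℕ) (g : (Fin s → ℕ) → CoordRing K N)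
    (h : ∑ a ∈ Finset.piAntidiag F k, g a * formMonomial (fun i => linearForm (φ i)) a ∈
      formIdeal (fun i => linearForm (φ i)) F ^ (k + 1)) :
    ∀ a ∈ Finset.piAntidiag F k, g a ∈ formIdeal (fun i => linearForm (φ i)) F := by
  classical
  set r : (Fin s → ℕ) → F →₀ ℕ := fun a => Finsupp.equivFunOnFinite.symm fun i => a i with hr
  have hmon : ∀ a ∈ Finset.piAntidiag F k, formMonomial (fun i => linearForm (φ i)) a =
      frameEquiv b (monomial (r a) 1) := by
    intro a ha
    rw [monomial_eq, C_1, one_mul, Finsupp.prod_fintype _ _ (by simp), map_prod, formMonomial,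
      ← Finset.prod_subset (Finset.subset_univ F), ← Finset.prod_coe_sort]
    · simp [hr, hb]
    · intro i _ hi
      have : a i = 0 := by
        by_contra hcon; exact hi ((Finset.mem_piAntidiag.1 ha).2 i hcon)
      rw [this, pow_zero]
  have hdeg : ∀ a ∈ Finset.piAntidiag F k, (r a).degree = k := by
    intro a ha
    rw [Finsupp.degree_eq_sum, ← (Finset.mem_piAntidiag.1 ha).1]
    exact Finset.sum_coe_sort F a
  have hinj : ∀ a ∈ Finset.piAntidiag F k, ∀ a' ∈ Finset.piAntidiag F k, r a = r a' → a = a' := by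
    intro a ha a' ha' h
    ext i
    by_cases hi : i ∈ F
    · exact DFunLike.congr_fun h ⟨i, hi⟩
    · have h1 : a i = 0 := by
        by_contra hcon; exact hi ((Finset.mem_piAntidiag.1 ha).2 i hcon)
      have h2 : a' i = 0 := by
        by_contra hcon; exact hi ((Finset.mem_piAntidiag.1 ha').2 i hcon)
      rw [h1, h2]
  obtain ⟨g', rfl⟩ : ∃ g' : (Fin s → ℕ) → _, g = fun a => frameEquiv b (g' a) :=
    ⟨fun a => (frameEquiv b).symm (g a), by simp⟩
  rw [Finset.sum_congr rfl fun a ha => by rw [hmon a ha, ← map_mul], ← map_sum,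
    frameEquiv_mem_formIdeal_pow_iff b hb, mem_pow_idealOfVars_iff'] at h
  intro a ha
  rw [← projHom_eq_zero_iff b hb, projHom_frameEquiv]
  have h1 := h (r a) (by rw [hdeg a ha]; exact Nat.lt_succ_self k)
  rw [coeff_sum, Finset.sum_eq_single_of_mem a ha] at h1
  · rw [coeff_mul_monomial', if_pos le_rfl, mul_one, tsub_self] at h1
    exact h1
  · intro a' ha' hne
    rw [coeff_mul_monomial', if_neg]
    intro hle
    refine hne (hinj a' ha' a ha ?_)
    obtain ⟨e, he⟩ := exists_add_of_le hle
    have h2 := congrArg Finsupp.degree he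
    rw [map_add, hdeg a ha, hdeg a' ha'] at h2
    have h3 : e = 0 := by rw [← Finsupp.degree_eq_zero_iff]; omega
    rw [he, h3, add_zero]

/-- Points of the linear space cut out by the first part of the basis. -/
lemma exists_point {θ : Fin d → Dual K (Fin (N + 1) → K)} (hθ : ∀ j, b (.inr j) = θ j)
    (z : Fin d → K) : ∃ v : Fin (N + 1) → K, (∀ i ∈ F, φ i v = 0) ∧ (∀ j, θ j v = z j) ∧
      ∀ f : CoordRing K N, eval v f = eval z (projHom b f) := by
  obtain ⟨v, hv⟩ := (evalEquiv K (Fin (N + 1) → K)).surjective (b.constr K (Sum.elim 0 z))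
  have hv' : ∀ w, w v = b.constr K (Sum.elim 0 z) w := fun w => by rw [← hv]; simp
  refine ⟨v, fun i hi => ?_, fun j => ?_, fun f => ?_⟩
  · rw [hv', ← hb ⟨i, hi⟩]; simp
  · rw [hv', ← hθ]; simp
  · have h1 : ∀ w, w v = eval z (projHom b (linearForm w)) := by
      intro w
      rw [hv', projHom_linearForm]
      have : b.constr K (Sum.elim 0 z) =
          (aeval z).toLinearMap ∘ₗ b.constr K (Sum.elim 0 (X : Fin d → MvPolynomial (Fin d) K)) :=
        b.ext (by rintro (i | j) <;> simp)
      rw [this]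
      simp
    have h2 : (aeval v : CoordRing K N →ₐ[K] K) = (aeval z).comp (projHom b) := by
      refine algHom_ext fun i => ?_
      have hX : (X i : CoordRing K N) = linearForm (coordBasis K N i) := by simp [linearForm]
      rw [hX]
      simpa [coe_aeval_eq_eval, -projHom_linearForm] using h1 (coordBasis K N i)
    have := DFunLike.congr_fun h2 f
    simpa [coe_aeval_eq_eval] using this

end Frame

end Coordinates

end PseudoStar

end

open scoped LinearAlgebra.Projectivization

noncomputable section

namespace PseudoStar

/-! ### A common complement in general position -/

section Generic

open Module Submodule

variable {K W : Type*} [Field K] [AddCommGroup W] [Module K W]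

lemma disjoint_span_insert {A : Submodule K W} {S : Set W} {x : W}
    (h : Disjoint A (span K S)) (hx : x ∉ A ⊔ span K S) : Disjoint A (span K (insert x S)) := by
  rw [Submodule.disjoint_def] at h ⊢
  intro y hy hyS
  obtain ⟨t, z, hz, rfl⟩ := mem_span_insert.1 hyS
  by_cases ht : t = 0
  · subst ht
    rw [zero_smul, zero_add] at hy ⊢
    exact h z hy hz
  · refine absurd ?_ hx
    rw [← smul_mem_iff _ ht]
    have : t • x = (t • x + z) - z := by abel
    rw [this]
    exact sub_mem (mem_sup_left hy) (mem_sup_right hz)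

variable [Infinite K] [FiniteDimensional K W] {s : ℕ} {φ : Fin s → W} {c : ℕ}

/-- Finitely many subspaces of the same dimension have a common complement. -/
theorem exists_linearIndependent_disjoint (φ : Fin s → W) (r : ℕ)
    (hr : r + c ≤ finrank K W) :
    ∃ θ : Fin r → W, LinearIndependent K θ ∧ ∀ F : Finset (Fin s), F.card = c →
      Disjoint (span K (φ '' F)) (span K (Set.range θ)) := by
  classical
  induction r with
  | zero => exact ⟨Fin.elim0, linearIndependent_empty_type, by simp⟩
  | succ r ih =>
    obtain ⟨θ, hθ, hdis⟩ := ih (by omega)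
    have hfr : finrank K (span K (Set.range θ)) = r := by
      rw [finrank_span_eq_card hθ, Fintype.card_fin]
    -- Over an infinite field finitely many proper subspaces do not cover W. The span of θ is listed
    -- separately so that independence holds even if there is no set of c indices.
    obtain ⟨x, hx⟩ : ∃ x : W, ∀ p ∈ insert (span K (Set.range θ))
        ((Finset.powersetCard c (Finset.univ : Finset (Fin s))).image
          fun F : Finset (Fin s) => span K (φ '' F) ⊔ span K (Set.range θ)), x ∉ p := by
      by_contra! hcon
      refine Subspace.biUnion_ne_univ_of_top_notMem (k := K) (E := W) (s := insert (span K (Set.range θ))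
        ((Finset.powersetCard c (Finset.univ : Finset (Fin s))).image
          fun F : Finset (Fin s) => span K (φ '' F) ⊔ span K (Set.range θ))) ?_ ?_
      · intro htop
        rw [Finset.mem_insert, Finset.mem_image] at htop
        rcases htop with htop | ⟨F, hF, htop⟩
        · rw [← htop, finrank_top] at hfr
          omega
        · have hF' : F.card = c := Finset.mem_powersetCard_univ.1 hF
          have h1 := finrank_add_le_finrank_add_finrank (span K (φ '' F)) (span K (Set.range θ))
          have h2 : finrank K (span K (φ '' F)) ≤ c := by
            rw [← hF', ← Finset.coe_image]
            exact (finrank_span_finset_le_card _).trans Finset.card_image_le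
          rw [htop, finrank_top] at h1
          omega
      · refine Set.eq_univ_of_forall fun x => ?_
        obtain ⟨p, hp, hxp⟩ := hcon x
        exact Set.mem_biUnion hp hxp
    refine ⟨Fin.cons x θ, linearIndependent_finCons.2 ⟨hθ, hx _ (Finset.mem_insert_self _ _)⟩,
      fun F hF => ?_⟩
    rw [Fin.range_cons]
    refine disjoint_span_insert (hdis F hF) (hx _ (Finset.mem_insert_of_mem ?_))
    exact Finset.mem_image_of_mem _ (Finset.mem_powersetCard_univ.2 hF)

/-- A common complement completes each part of the family to a basis. -/
theorem exists_common_basis (hφ : ∀ F : Finset (Fin s), F.card = c → LinearIndepOn K φ F) {d : ℕ}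
    (hd : d + c = finrank K W) :
    ∃ θ : Fin d → W, ∀ F : Finset (Fin s), F.card = c →
      ∃ b : Basis (F ⊕ Fin d) K W, (∀ i : F, b (.inl i) = φ i) ∧ ∀ j, b (.inr j) = θ j := by
  obtain ⟨θ, hθ, hdis⟩ := exists_linearIndependent_disjoint φ d hd.le
  refine ⟨θ, fun F hF => ?_⟩
  have hF' : LinearIndependent K fun i : F => φ i := hφ F hF
  have hli : LinearIndependent K (Sum.elim (fun i : F => φ i) θ) := by
    refine hF'.sum_type hθ ?_
    convert! hdis F hF using 2
    ext x; simp
  have hcard : Fintype.card (F ⊕ Fin d) = finrank K W := by simp [hF]; omega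
  by_cases hne : Nonempty (F ⊕ Fin d)
  · exact ⟨basisOfLinearIndependentOfCardEqFinrank hli hcard, by simp, by simp⟩
  · have : IsEmpty (F ⊕ Fin d) := not_nonempty_iff.1 hne
    have h0 : finrank K W = 0 := by rw [← hcard, Fintype.card_eq_zero]
    have := finrank_zero_iff.1 h0
    exact ⟨Basis.empty W, fun i => (this.elim _ _), fun i => (this.elim _ _)⟩

end Generic

/-! ### From the filtration to the Cohen-Macaulay property -/

section CohenMacaulay

open Module

/-- The sequence splits because the quotient is projective. -/
lemma finite_and_projective_of_exact {T M M' M'' : Type*} [CommRing T] [AddCommGroup M]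
    [AddCommGroup M'] [AddCommGroup M''] [Module T M] [Module T M'] [Module T M'']
    (f : M' →ₗ[T] M) (g : M →ₗ[T] M'') (hf : Function.Injective f) (hg : Function.Surjective g)
    (hfg : Function.Exact f g) [Module.Finite T M'] [Module.Finite T M''] [Projective T M']
    [Projective T M''] : Module.Finite T M ∧ Projective T M := by
  obtain ⟨l, hl⟩ := projective_lifting_property g LinearMap.id hg
  obtain ⟨e, -, -⟩ := ((Function.Exact.split_tfae' hfg).out 0 2 rfl rfl).mp ⟨hf, l, hl⟩
  exact ⟨Module.Finite.equiv e.symm, Projective.of_equiv e.symm⟩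

section ColonSequence

variable {R : Type*} [CommRing R] {I J P : Ideal R} {u : R}

/-- Multiplication by `u`, as a map to `R ⧸ I` from the quotient by the colon ideal of `u`. -/
def colonMap (h : ∀ g, g * u ∈ I ↔ g ∈ P) : (R ⧸ P) →ₗ[R] R ⧸ I :=
  Submodule.mapQ P I (LinearMap.mulRight R u) fun g hg => (h g).2 hg

@[simp]
lemma colonMap_mk (h : ∀ g, g * u ∈ I ↔ g ∈ P) (x : R) :
    colonMap h (Ideal.Quotient.mk P x) = Ideal.Quotient.mk I (x * u) := rfl

lemma colonMap_injective (h : ∀ g, g * u ∈ I ↔ g ∈ P) : Function.Injective (colonMap h) := by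
  rw [injective_iff_map_eq_zero]
  intro x hx
  obtain ⟨x, rfl⟩ := Ideal.Quotient.mk_surjective x
  rw [colonMap_mk, Ideal.Quotient.eq_zero_iff_mem] at hx
  exact Ideal.Quotient.eq_zero_iff_mem.2 ((h x).1 hx)

/-- The quotient map for a larger ideal. -/
def quotientMap (h : I ≤ J) : (R ⧸ I) →ₗ[R] R ⧸ J := Submodule.factor h

@[simp]
lemma quotientMap_mk (h : I ≤ J) (x : R) :
    quotientMap h (Ideal.Quotient.mk I x) = Ideal.Quotient.mk J x := rfl

lemma quotientMap_surjective (h : I ≤ J) : Function.Surjective (quotientMap h) :=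
  Submodule.factor_surjective h

lemma exact_colonMap_quotientMap (h : ∀ g, g * u ∈ I ↔ g ∈ P) (hJ : J = Ideal.span {u} ⊔ I) :
    Function.Exact (colonMap h) (quotientMap (hJ ▸ le_sup_right : I ≤ J)) := by
  intro x
  obtain ⟨x, rfl⟩ := Ideal.Quotient.mk_surjective x
  rw [quotientMap_mk, Ideal.Quotient.eq_zero_iff_mem]
  constructor
  · intro hx
    rw [hJ, Submodule.mem_sup] at hx
    obtain ⟨y, hy, z, hz, rfl⟩ := hx
    obtain ⟨a, rfl⟩ := Ideal.mem_span_singleton'.1 hy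
    refine ⟨Ideal.Quotient.mk P a, ?_⟩
    rw [colonMap_mk, map_add, Ideal.Quotient.eq_zero_iff_mem.2 hz, add_zero]
  · rintro ⟨y, hy⟩
    obtain ⟨y, rfl⟩ := Ideal.Quotient.mk_surjective y
    rw [colonMap_mk, Ideal.Quotient.eq] at hy
    have h1 : y * u ∈ J := hJ ▸ Submodule.mem_sup_left
      (Ideal.mul_mem_left _ _ (Ideal.mem_span_singleton_self u))
    have h2 : y * u - x ∈ J := hJ ▸ Submodule.mem_sup_right hy
    simpa using sub_mem h1 h2

end ColonSequence

lemma finite_and_projective_of_colon {T R : Type*} [CommRing T] [CommRing R] [Algebra T R]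
    {I J P : Ideal R} {u : R} (h : ∀ g, g * u ∈ I ↔ g ∈ P) (hJ : J = Ideal.span {u} ⊔ I)
    [h1 : Module.Finite T (R ⧸ P)] [h2 : Projective T (R ⧸ P)]
    [h3 : Module.Finite T (R ⧸ J)] [h4 : Projective T (R ⧸ J)] :
    Module.Finite T (R ⧸ I) ∧ Projective T (R ⧸ I) := by
  have hex := exact_colonMap_quotientMap h hJ
  have hinj := colonMap_injective h
  have hsurj := quotientMap_surjective (hJ ▸ le_sup_right : I ≤ J)
  generalize colonMap h = f at *
  generalize quotientMap (hJ ▸ le_sup_right : I ≤ J) = g at *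
  exact finite_and_projective_of_exact (f.restrictScalars T) (g.restrictScalars T) hinj hsurj hex

lemma CleanFiltration.finite_and_projective {T R : Type*} [CommRing T] [CommRing R] [Algebra T R]
    {Ps : Set (Ideal R)} {Gs : Set R}
    (hP : ∀ P ∈ Ps, Module.Finite T (R ⧸ P) ∧ Projective T (R ⧸ P)) {n : ℕ} {I : Ideal R}
    (h : CleanFiltration Ps Gs n I) : Module.Finite T (R ⧸ I) ∧ Projective T (R ⧸ I) := by
  induction h with
  | top =>
    have : Subsingleton (R ⧸ (⊤ : Ideal R)) := Ideal.Quotient.subsingleton_iff.2 rfl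
    exact ⟨inferInstance, inferInstance⟩
  | @step n S u P hS hu hPs hcolon h ih =>
    obtain ⟨h1, h2⟩ := ih
    obtain ⟨h3, h4⟩ := hP P hPs
    exact finite_and_projective_of_colon hcolon (Ideal.span_insert u S)

variable {K : Type*} [Field K] {N s c d : ℕ} {φ : Fin s → Dual K (Fin (N + 1) → K)}
  {θ : Fin d → Dual K (Fin (N + 1) → K)}

theorem isStarFamily_linearForm
    (hb : ∀ F : Finset (Fin s), F.card = c →
      ∃ b : Basis (F ⊕ Fin d) K (Dual K (Fin (N + 1) → K)),
        (∀ i : F, b (.inl i) = φ i) ∧ ∀ j, b (.inr j) = θ j)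
    (hφ : ∀ F : Finset (Fin s), F.card = c → ∀ j ∉ F, φ j ∉ Submodule.span K (φ '' F)) :
    IsStarFamily (fun i => linearForm (φ i)) c where
  isPrime F hF := by
    obtain ⟨b, hb, -⟩ := hb F hF
    exact isPrime_formIdeal b hb
  notMem F hF j hj := by
    obtain ⟨b, hb, -⟩ := hb F hF
    rw [linearForm_mem_formIdeal_iff b hb]
    exact hφ F hF j hj
  quasiRegular F hF := by
    obtain ⟨b, hb, -⟩ := hb F hF
    exact quasiRegular_formIdeal b hb

theorem isCMRing_of_cleanFiltration
    (hb : ∀ F : Finset (Fin s), F.card = c →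
      ∃ b : Basis (F ⊕ Fin d) K (Dual K (Fin (N + 1) → K)),
        (∀ i : F, b (.inl i) = φ i) ∧ ∀ j, b (.inr j) = θ j)
    {Gs : Set (CoordRing K N)} {n : ℕ} {I : Ideal (CoordRing K N)}
    (h : CleanFiltration (formIdeals (fun i => linearForm (φ i)) c) Gs n I) :
    IsCMRing (CoordRing K N ⧸ I) := by
  -- The forms θ are common to all F, so one polynomial ring serves as a Noether normalization of
  -- every factor, and each R/I_F is free of rank one over it.
  let : Algebra (MvPolynomial (Fin d) K) (CoordRing K N) := (coordHom θ).toAlgebra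
  obtain ⟨h1, h2⟩ := h.finite_and_projective (T := MvPolynomial (Fin d) K) (by
    rintro _ ⟨F, hF, rfl⟩
    obtain ⟨b, hb, hθ⟩ := hb F hF
    have hbij : Function.Bijective (Algebra.linearMap (MvPolynomial (Fin d) K)
        (CoordRing K N ⧸ formIdeal (fun i => linearForm (φ i)) F)) := by
      constructor
      · rw [← LinearMap.ker_eq_bot, LinearMap.ker_eq_bot']
        intro t ht
        have : coordHom θ t ∈ formIdeal (fun i => linearForm (φ i)) F :=
          Ideal.Quotient.eq_zero_iff_mem.1 ht
        rw [← projHom_eq_zero_iff b hb, projHom_coordHom b hθ] at this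
        exact this
      · intro x
        obtain ⟨x, rfl⟩ := Ideal.Quotient.mk_surjective x
        refine ⟨projHom b x, ?_⟩
        change Ideal.Quotient.mk _ (coordHom θ (projHom b x)) = _
        rw [Ideal.Quotient.eq, ← projHom_eq_zero_iff b hb, map_sub, projHom_coordHom b hθ, sub_self]
    let e := LinearEquiv.ofBijective _ hbij
    exact ⟨Module.Finite.equiv e, Projective.of_equiv e⟩)
  exact isCMRing_of_finite_of_flat (MvPolynomial (Fin d) K) _

end CohenMacaulay

end PseudoStar

end

open scoped LinearAlgebra.Projectivization

noncomputable section

namespace PseudoStar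

/-! ### Hilbert functions and the degree -/

section Hilbert

open MvPolynomial Module

section Homogeneous

variable {σ K : Type*} [CommRing K]

lemma homogeneousComponent_mul_of_le {u : MvPolynomial σ K} {e t : ℕ} (hu : u.IsHomogeneous e)
    (he : e ≤ t) (a : MvPolynomial σ K) :
    homogeneousComponent t (a * u) = homogeneousComponent (t - e) a * u := by
  classical
  let := gradedAlgebra (σ := σ) (R := K)
  have := DirectSum.coe_decompose_mul_of_right_mem_of_le (homogeneousSubmodule σ K) (a := a)
    ((mem_homogeneousSubmodule e u).2 hu) he
  rwa [show DirectSum.decompose (homogeneousSubmodule σ K) (a * u) =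
    decomposition.decompose' (a * u) from rfl, show DirectSum.decompose (homogeneousSubmodule σ K) a =
    decomposition.decompose' a from rfl, decomposition.decompose'_apply,
    decomposition.decompose'_apply] at this

lemma homogeneousComponent_mul_of_lt {u : MvPolynomial σ K} {e t : ℕ} (hu : u.IsHomogeneous e)
    (he : t < e) (a : MvPolynomial σ K) : homogeneousComponent t (a * u) = 0 := by
  classical
  let := gradedAlgebra (σ := σ) (R := K)
  have := DirectSum.coe_decompose_mul_of_right_mem_of_not_le (homogeneousSubmodule σ K) (a := a)
    ((mem_homogeneousSubmodule e u).2 hu) he.not_ge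
  rwa [show DirectSum.decompose (homogeneousSubmodule σ K) (a * u) =
    decomposition.decompose' (a * u) from rfl, decomposition.decompose'_apply] at this

lemma homogeneousComponent_mem_span {S : Set (MvPolynomial σ K)}
    (hS : ∀ f ∈ S, ∃ e, f.IsHomogeneous e) {f : MvPolynomial σ K} (hf : f ∈ Ideal.span S) (t : ℕ) :
    homogeneousComponent t f ∈ Ideal.span S := by
  classical
  let := gradedAlgebra (σ := σ) (R := K)
  exact homogeneousComponent_mem_of_mem
    (Ideal.homogeneous_span (homogeneousSubmodule σ K) S fun x hx => hS x hx) hf t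

end Homogeneous

lemma finrank_homogeneousSubmodule (K : Type*) [Field K] (D t : ℕ) :
    finrank K (homogeneousSubmodule (Fin (D + 1)) K t) = (t + D).choose D := by
  rw [homogeneousSubmodule_eq_finsupp_supported,
    (AddMonoidAlgebra.supportedEquivFinsupp {d : Fin (D + 1) →₀ ℕ | d.degree = t}).finrank_eq]
  have hset : {d : Fin (D + 1) →₀ ℕ | d.degree = t} =
      ((Finset.univ : Finset (Fin (D + 1))).finsuppAntidiag t : Set _) := by
    ext d
    simp [Finset.mem_finsuppAntidiag, Finsupp.degree_eq_sum]
  rw [hset, Module.finrank_finsupp_self, show Fintype.card ((Finset.univ.finsuppAntidiag t : Finset (Fin (D + 1) →₀ ℕ)) :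
      Set (Fin (D + 1) →₀ ℕ)) = _ from Fintype.card_coe _,
    Finset.card_finsuppAntidiag_nat_eq_choose, Finset.card_univ, Fintype.card_fin,
    show D + 1 + t - 1 = t + D by omega, Nat.choose_symm_add]

variable {K : Type*} [Field K] {N : ℕ}

instance (t : ℕ) : FiniteDimensional K (homogeneousSubmodule (Fin (N + 1)) K t) :=
  Module.Finite.iff_fg.2 (homogeneousSubmodule_fg _ _ t)

lemma mem_gradedPiece {I : Ideal (CoordRing K N)} {t : ℕ}
    {f : homogeneousSubmodule (Fin (N + 1)) K t} : f ∈ gradedPiece I t ↔ (f : CoordRing K N) ∈ I :=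
  Iff.rfl

lemma hilbertFunction_top (t : ℕ) : hilbertFunction (⊤ : Ideal (CoordRing K N)) t = 0 := by
  have : gradedPiece (⊤ : Ideal (CoordRing K N)) t = ⊤ := by
    ext; simp [mem_gradedPiece]
  rw [hilbertFunction, this]
  have : Subsingleton (homogeneousSubmodule (Fin (N + 1)) K t ⧸
      (⊤ : Submodule K (homogeneousSubmodule (Fin (N + 1)) K t))) :=
    Submodule.Quotient.subsingleton_iff.2 rfl
  exact finrank_zero_of_subsingleton

/-- R/I_F is a polynomial ring in D + 1 variables, where D is the dimension of the linear space. -/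
lemma hilbertFunction_formIdeal {s D : ℕ} {F : Finset (Fin s)}
    (b : Basis (F ⊕ Fin (D + 1)) K (Dual K (Fin (N + 1) → K)))
    {φ : Fin s → Dual K (Fin (N + 1) → K)} (hb : ∀ i : F, b (.inl i) = φ i) (t : ℕ) :
    hilbertFunction (formIdeal (fun i => linearForm (φ i)) F) t = (t + D).choose D := by
  let p : homogeneousSubmodule (Fin (N + 1)) K t →ₗ[K] homogeneousSubmodule (Fin (D + 1)) K t :=
    (projHom b).toLinearMap.restrict fun f hf => isHomogeneous_projHom b hf
  have hker : gradedPiece (formIdeal (fun i => linearForm (φ i)) F) t = LinearMap.ker p := by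
    ext f
    rw [mem_gradedPiece, ← projHom_eq_zero_iff b hb, LinearMap.mem_ker, ← Subtype.coe_inj]
    rfl
  have hsurj : Function.Surjective p := by
    intro g
    refine ⟨⟨coordHom (fun j => b (.inr j)) g, isHomogeneous_coordHom _ g.2⟩, ?_⟩
    exact Subtype.ext (projHom_coordHom b (fun _ => rfl) _)
  rw [hilbertFunction, hker, (p.quotKerEquivOfSurjective hsurj).finrank_eq,
    finrank_homogeneousSubmodule]

lemma gradedPiece_mono {I J : Ideal (CoordRing K N)} (h : I ≤ J) (t : ℕ) :
    gradedPiece I t ≤ gradedPiece J t := fun _ hf => h hf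

/-- The Hilbert function is additive along a colon sequence. -/
lemma hilbertFunction_eq_add {S : Set (CoordRing K N)} (hS : ∀ f ∈ S, ∃ e, f.IsHomogeneous e)
    {P : Ideal (CoordRing K N)} {u : CoordRing K N} {e : ℕ} (hu : u.IsHomogeneous e)
    (h : ∀ g, g * u ∈ Ideal.span S ↔ g ∈ P) {t : ℕ} (het : e ≤ t) :
    hilbertFunction (Ideal.span S) t =
      hilbertFunction P (t - e) + hilbertFunction (Ideal.span (insert u S)) t := by
  have hle : Ideal.span S ≤ Ideal.span (insert u S) := Ideal.span_mono (Set.subset_insert _ _)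
  let mu : homogeneousSubmodule (Fin (N + 1)) K (t - e) →ₗ[K]
      homogeneousSubmodule (Fin (N + 1)) K t :=
    (LinearMap.mulRight K u).restrict fun f hf => by
      have := IsHomogeneous.mul hf hu
      rwa [Nat.sub_add_cancel het] at this
  have hmu : ∀ f, ((mu f : homogeneousSubmodule (Fin (N + 1)) K t) : CoordRing K N) = f * u :=
    fun f => rfl
  let f : (homogeneousSubmodule (Fin (N + 1)) K (t - e) ⧸ gradedPiece P (t - e)) →ₗ[K]
      (homogeneousSubmodule (Fin (N + 1)) K t ⧸ gradedPiece (Ideal.span S) t) :=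
    Submodule.mapQ _ _ mu fun x hx => (h x).2 hx
  let g : (homogeneousSubmodule (Fin (N + 1)) K t ⧸ gradedPiece (Ideal.span S) t) →ₗ[K]
      (homogeneousSubmodule (Fin (N + 1)) K t ⧸ gradedPiece (Ideal.span (insert u S)) t) :=
    Submodule.factor (gradedPiece_mono hle t)
  have hg : Function.Surjective g := Submodule.factor_surjective _
  have hf : Function.Injective f := by
    rw [injective_iff_map_eq_zero]
    intro x hx
    obtain ⟨x, rfl⟩ := Submodule.Quotient.mk_surjective _ x
    have hx' : mu x ∈ gradedPiece (Ideal.span S) t := (Submodule.Quotient.mk_eq_zero _).1 hx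
    exact (Submodule.Quotient.mk_eq_zero _).2 ((h x).1 hx')
  have hex : LinearMap.ker g = LinearMap.range f := by
    ext x
    obtain ⟨x, rfl⟩ := Submodule.Quotient.mk_surjective _ x
    rw [LinearMap.mem_ker, LinearMap.mem_range]
    have hgx : g (Submodule.Quotient.mk x) = 0 ↔ (x : CoordRing K N) ∈ Ideal.span (insert u S) :=
      Submodule.Quotient.mk_eq_zero _
    rw [hgx]
    constructor
    · intro hx
      -- In x = a u + z only the component of a in degree t - e matters, since x is homogeneous of
      -- degree t.
      obtain ⟨a, z, hz, hxa⟩ := Ideal.mem_span_insert.1 hx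
      refine ⟨Submodule.Quotient.mk ⟨homogeneousComponent (t - e) a,
        homogeneousComponent_isHomogeneous _ _⟩, ?_⟩
      refine (Submodule.Quotient.eq _).2 ?_
      rw [mem_gradedPiece, Submodule.coe_sub, hmu]
      have h1 : homogeneousComponent t (x : CoordRing K N) = x := by
        rw [homogeneousComponent_of_mem x.2, if_pos rfl]
      rw [← h1, hxa, map_add, homogeneousComponent_mul_of_le hu het, sub_add_cancel_left]
      exact neg_mem (homogeneousComponent_mem_span hS hz t)
    · rintro ⟨y, hy⟩
      obtain ⟨y, rfl⟩ := Submodule.Quotient.mk_surjective _ y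
      have h1 : mu y - x ∈ gradedPiece (Ideal.span S) t := (Submodule.Quotient.eq _).1 hy
      rw [mem_gradedPiece, Submodule.coe_sub, hmu] at h1
      have h2 : (y : CoordRing K N) * u ∈ Ideal.span (insert u S) :=
        Ideal.mul_mem_left _ _ (Ideal.subset_span (Set.mem_insert _ _))
      simpa using sub_mem h2 (hle h1)
  have h1 := LinearMap.finrank_range_add_finrank_ker g
  rw [LinearMap.range_eq_top.2 hg, finrank_top, hex, LinearMap.finrank_range_of_inj hf] at h1
  rw [hilbertFunction, hilbertFunction, hilbertFunction]
  omega

/-- Each factor, shifted by the degree e of its generator, contributes binom(t - e + D, D), whose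
leading coefficient 1/D! does not depend on e. The coefficient at D is tracked, since the induction
starts at the zero polynomial. -/
lemma CleanFiltration.exists_hilbertPoly {Ps : Set (Ideal (CoordRing K N))}
    {Gs : Set (CoordRing K N)} (hGs : ∀ f ∈ Gs, ∃ e, f.IsHomogeneous e) {D : ℕ}
    (hPs : ∀ P ∈ Ps, ∀ t, hilbertFunction P t = (t + D).choose D) {n : ℕ}
    {I : Ideal (CoordRing K N)} (h : CleanFiltration Ps Gs n I) :
    ∃ p : Polynomial ℚ, (∀ᶠ t : ℕ in Filter.atTop, (hilbertFunction I t : ℚ) = p.eval (t : ℚ)) ∧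
      p.natDegree ≤ D ∧ p.coeff D = n / (D.factorial : ℚ) := by
  induction h with
  | top => exact ⟨0, by simp [hilbertFunction_top], by simp, by simp⟩
  | @step n S u P hS hu hP hcolon _ ih =>
    obtain ⟨p, hp, hdeg, hcoeff⟩ := ih
    obtain ⟨e, he⟩ := hGs u hu
    refine ⟨Polynomial.preHilbertPoly ℚ D e + p, ?_, ?_, ?_⟩
    · filter_upwards [hp, Filter.eventually_ge_atTop e] with t ht hte
      rw [hilbertFunction_eq_add (fun f hf => hGs f (hS hf)) he hcolon hte, hPs P hP,
        Polynomial.eval_add, Polynomial.preHilbertPoly_eq_choose_sub_add ℚ D hte, Nat.cast_add, ht]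
    · exact Polynomial.natDegree_add_le_of_degree_le (Polynomial.natDegree_preHilbertPoly ℚ D e).le
        hdeg
    · rw [Polynomial.coeff_add, Polynomial.coeff_preHilbertPoly_self, hcoeff]
      push_cast
      ring

theorem CleanFiltration.hasDegree {Ps : Set (Ideal (CoordRing K N))}
    {Gs : Set (CoordRing K N)} (hGs : ∀ f ∈ Gs, ∃ e, f.IsHomogeneous e) {D : ℕ}
    (hPs : ∀ P ∈ Ps, ∀ t, hilbertFunction P t = (t + D).choose D) {n : ℕ} (hn : n ≠ 0)
    {I : Ideal (CoordRing K N)} (h : CleanFiltration Ps Gs n I) : HasDegree I n := by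
  obtain ⟨p, hp, hdeg, hcoeff⟩ := h.exists_hilbertPoly hGs hPs
  have hD : (D.factorial : ℚ) ≠ 0 := by exact_mod_cast D.factorial_ne_zero
  have hne : p.coeff D ≠ 0 := by
    rw [hcoeff]
    exact div_ne_zero (by exact_mod_cast hn) hD
  have hdeg' : p.natDegree = D := le_antisymm hdeg (Polynomial.le_natDegree_of_ne_zero hne)
  refine ⟨p, hp, ?_⟩
  rw [Polynomial.leadingCoeff, hdeg', hcoeff, div_mul_cancel₀ _ hD]

end Hilbert

end PseudoStar

end

open scoped LinearAlgebra.Projectivization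

noncomputable section

namespace PseudoStar

/-! ### Associated primes and symbolic powers -/

section Symbolic

open Finset

namespace IsStarFamily

variable {R : Type*} [CommRing R] {s : ℕ} {ℓ : Fin s → R} {c : ℕ}

omit ℓ in
lemma formIdeal_pow_le_span (ℓ : Fin s → R) (F : Finset (Fin s)) (k : ℕ) :
    formIdeal ℓ F ^ k ≤ Ideal.span (formMonomial ℓ '' (piAntidiag F k : Set _)) := by
  classical
  induction k with
  | zero =>
    rw [pow_zero, Ideal.one_eq_top, top_le_iff, Ideal.eq_top_iff_one]
    exact Ideal.subset_span ⟨0, by simp, by simp [formMonomial]⟩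
  | succ k ih =>
    rw [pow_succ]
    refine (Ideal.mul_mono_left ih).trans ?_
    rw [formIdeal, Ideal.span_mul_span', Ideal.span_le]
    rintro _ ⟨_, ⟨b, hb, rfl⟩, _, ⟨i, hi, rfl⟩, rfl⟩
    refine Ideal.subset_span ⟨b + Pi.single i 1, ?_, ?_⟩
    · rw [mem_coe, mem_piAntidiag] at hb ⊢
      refine ⟨?_, fun j hj => ?_⟩
      · simp only [Pi.add_apply, sum_add_distrib]
        rw [hb.1, sum_pi_single', if_pos (mem_coe.1 hi)]
      · by_cases hji : j = i
        · exact hji ▸ hi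
        · exact hb.2 j (by simpa [hji] using hj)
    · rw [formMonomial_add]
      congr 1
      rw [formMonomial, Fintype.prod_eq_single i]
      · simp
      · intro j hj; simp [hj]

variable (hℓ : IsStarFamily ℓ c)
include hℓ

/-- Powers of I_F are primary: if y ∈ I_F ^ k and t y ∈ I_F ^ (k + 1), quasi-regularity puts t times
each coefficient of y in the prime I_F, so the coefficients are in I_F. -/
lemma mem_pow_of_mul_mem_pow {F : Finset (Fin s)} (hF : F.card = c) {t y : R}
    (ht : t ∉ formIdeal ℓ F) (m : ℕ) (h : t * y ∈ formIdeal ℓ F ^ m) :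
    y ∈ formIdeal ℓ F ^ m := by
  suffices H : ∀ k ≤ m, y ∈ formIdeal ℓ F ^ k from H m le_rfl
  intro k
  induction k with
  | zero => simp
  | succ k ih =>
    intro hk
    obtain ⟨f, rfl⟩ := (Submodule.mem_span_image_finset_iff_exists_fun' R).1
      (formIdeal_pow_le_span ℓ F k (ih (by omega)))
    have h1 : ∑ b ∈ piAntidiag F k, (t * f b) * formMonomial ℓ b ∈ formIdeal ℓ F ^ (k + 1) := by
      have := Ideal.pow_le_pow_right hk h
      rw [mul_sum] at this
      simpa only [smul_eq_mul, mul_assoc] using this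
    have h2 := hℓ.quasiRegular F hF k _ h1
    refine Ideal.sum_mem _ fun b hb => ?_
    rw [pow_succ', smul_eq_mul]
    refine Ideal.mul_mem_mul (((hℓ.isPrime F hF).mem_or_mem (h2 b hb)).resolve_left ht) ?_
    have := formMonomial_mem_pow (ℓ := ℓ) b F
    rwa [(mem_piAntidiag.1 hb).1] at this

lemma prod_compl_notMem {F : Finset (Fin s)} (hF : F.card = c) :
    ∏ j ∈ Fᶜ, ℓ j ∉ formIdeal ℓ F := by
  intro h
  obtain ⟨j, hj, hj'⟩ := (hℓ.isPrime F hF).prod_mem_iff.1 h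
  exact hℓ.notMem F hF j (mem_compl.1 hj) hj'

omit hℓ in
lemma prod_compl_mem {F F' : Finset (Fin s)} (hF : F.card = c) (hF' : F'.card = c)
    (hne : F' ≠ F) : ∏ j ∈ Fᶜ, ℓ j ∈ formIdeal ℓ F' := by
  have : ¬ F' ⊆ F := fun h => hne (eq_of_subset_of_card_le h (hF.trans hF'.symm).le)
  obtain ⟨j, hj, hjF⟩ := not_subset.1 this
  exact Ideal.mem_of_dvd _ (dvd_prod_of_mem ℓ (mem_compl.2 hjF))
    (Ideal.subset_span (Set.mem_image_of_mem ℓ (mem_coe.2 hj)))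

/-- The product of the forms outside F lies in every I_F' with F' ≠ F but not in I_F, so its colon
ideal is I_F. This exhibits I_F as an associated prime. -/
lemma mul_prod_compl_mem_iff {F : Finset (Fin s)} (hF : F.card = c) (g : R) :
    g * ∏ j ∈ Fᶜ, ℓ j ∈ (⨅ (F : Finset (Fin s)) (_ : F.card = c), formIdeal ℓ F) ↔
      g ∈ formIdeal ℓ F := by
  simp only [Ideal.mem_iInf]
  constructor
  · intro h
    exact ((hℓ.isPrime F hF).mem_or_mem (h F hF)).resolve_right (hℓ.prod_compl_notMem hF)
  · intro h F' hF'
    by_cases hne : F' = F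
    · subst hne
      exact Ideal.mul_mem_right _ _ h
    · exact Ideal.mul_mem_left _ _ (prod_compl_mem hF hF' hne)

lemma mem_associatedPrimes_iff (P : Ideal R) :
    P ∈ associatedPrimes R (R ⧸ ⨅ (F : Finset (Fin s)) (_ : F.card = c), formIdeal ℓ F) ↔
      ∃ F : Finset (Fin s), F.card = c ∧ P = formIdeal ℓ F := by
  classical
  set I := ⨅ (F : Finset (Fin s)) (_ : F.card = c), formIdeal ℓ F with hI
  have hcolon : ∀ x g : R, g ∈ Submodule.colon (⊥ : Submodule R (R ⧸ I))
      {Ideal.Quotient.mk I x} ↔ g * x ∈ I := by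
    intro x g
    rw [Submodule.mem_colon_singleton, Submodule.mem_bot]
    exact Ideal.Quotient.eq_zero_iff_mem
  constructor
  · rintro ⟨hP, x, hx⟩
    obtain ⟨x, rfl⟩ := Ideal.Quotient.mk_surjective x
    set A := {F ∈ powersetCard c (univ : Finset (Fin s)) | x ∉ formIdeal ℓ F} with hA
    -- The annihilator of x contains the intersection of those I_F that miss x, so the prime P
    -- contains one of them. For the reverse inclusion, the annihilator of x lies in any I_F missing
    -- x.
    have hle : A.inf (fun F => formIdeal ℓ F) ≤ P := by
      intro g hg
      rw [hx]
      refine Ideal.le_radical ((hcolon x g).2 ?_)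
      rw [hI]
      simp only [Ideal.mem_iInf]
      intro F hF
      by_cases hxF : x ∈ formIdeal ℓ F
      · exact Ideal.mul_mem_left _ _ hxF
      · refine Ideal.mul_mem_right _ _ (Finset.inf_le (f := fun F => formIdeal ℓ F) ?_ hg)
        exact mem_filter.2 ⟨mem_powersetCard_univ.2 hF, hxF⟩
    obtain ⟨F, hFA, hFP⟩ := hP.inf_le'.1 hle
    obtain ⟨hF, hxF⟩ := mem_filter.1 hFA
    have hF' : F.card = c := mem_powersetCard_univ.1 hF
    refine ⟨F, hF', le_antisymm ?_ hFP⟩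
    intro g hg
    rw [hx] at hg
    obtain ⟨n, hn⟩ := hg
    have h1 := (hcolon x _).1 hn
    rw [hI] at h1
    simp only [Ideal.mem_iInf] at h1
    have hp := hℓ.isPrime F hF'
    exact hp.mem_of_pow_mem n ((hp.mem_or_mem (h1 F hF')).resolve_right hxF)
  · rintro ⟨F, hF, rfl⟩
    have hp := hℓ.isPrime F hF
    refine ⟨hp, Ideal.Quotient.mk I (∏ j ∈ Fᶜ, ℓ j), ?_⟩
    have : Submodule.colon (⊥ : Submodule R (R ⧸ I)) {Ideal.Quotient.mk I (∏ j ∈ Fᶜ, ℓ j)} =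
        formIdeal ℓ F := by
      ext g
      rw [hcolon, hℓ.mul_prod_compl_mem_iff hF]
    rw [this, hp.radical]

/-- Multiplication by the product of the forms outside F, a unit at I_F, carries I_F into I; hence I
and I_F have the same localization there. Primariness of I_F ^ m then identifies the contraction. -/
lemma comap_map_pow {F : Finset (Fin s)} (hF : F.card = c) (m : ℕ)
    [(formIdeal ℓ F).IsPrime] :
    (((⨅ (F : Finset (Fin s)) (_ : F.card = c), formIdeal ℓ F) ^ m).map
      (algebraMap R (Localization.AtPrime (formIdeal ℓ F)))).comap
      (algebraMap R (Localization.AtPrime (formIdeal ℓ F))) = formIdeal ℓ F ^ m := by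
  set I := ⨅ (F : Finset (Fin s)) (_ : F.card = c), formIdeal ℓ F with hI
  ext y
  rw [Ideal.mem_comap, IsLocalization.algebraMap_mem_map_algebraMap_iff
    (formIdeal ℓ F).primeCompl]
  constructor
  · rintro ⟨t, ht, hty⟩
    refine hℓ.mem_pow_of_mul_mem_pow hF ht m ?_
    exact Ideal.pow_right_mono (iInf₂_le F hF) m hty
  · intro hy
    refine ⟨(∏ j ∈ Fᶜ, ℓ j) ^ m, ?_, ?_⟩
    · exact Submonoid.pow_mem _ (hℓ.prod_compl_notMem hF) _
    · have h1 : Ideal.span {∏ j ∈ Fᶜ, ℓ j} * formIdeal ℓ F ≤ I := by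
        rw [Ideal.span_singleton_mul_le_iff]
        intro g hg
        rw [mul_comm, hI, hℓ.mul_prod_compl_mem_iff hF]
        exact hg
      have h2 := Ideal.pow_right_mono h1 m
      rw [mul_pow, Ideal.span_singleton_pow] at h2
      exact h2 (Ideal.mul_mem_mul (Ideal.mem_span_singleton_self _) hy)

theorem symbolicPower_eq (m : ℕ) :
    symbolicPower (⨅ (F : Finset (Fin s)) (_ : F.card = c), formIdeal ℓ F) m =
      ⨅ (F : Finset (Fin s)) (_ : F.card = c), formIdeal ℓ F ^ m := by
  apply le_antisymm
  · refine le_iInf₂ fun F hF => ?_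
    have hp := hℓ.isPrime F hF
    rw [← hℓ.comap_map_pow hF m]
    exact iInf₂_le (⟨formIdeal ℓ F, hp⟩ : PrimeSpectrum R)
      ((hℓ.mem_associatedPrimes_iff _).2 ⟨F, hF, rfl⟩)
  · refine le_iInf₂ fun P hP => ?_
    obtain ⟨F, hF, hPF⟩ := (hℓ.mem_associatedPrimes_iff _).1 hP
    obtain ⟨P, hp⟩ := P
    obtain rfl : P = formIdeal ℓ F := hPF
    rw [hℓ.comap_map_pow hF m]
    exact iInf₂_le F hF

end IsStarFamily

end Symbolic

/-! ### Ideals generated in a single degree -/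

section Generators

open MvPolynomial

variable {K : Type*} [Field K] {N a : ℕ} {G : Set (CoordRing K N)}

lemma homogeneousComponent_eq_zero_of_mem_span (hG : ∀ g ∈ G, g.IsHomogeneous a)
    {f : CoordRing K N} (hf : f ∈ Ideal.span G) {t : ℕ} (ht : t < a) :
    homogeneousComponent t f = 0 := by
  obtain ⟨n, r, g, rfl⟩ := Submodule.mem_span_set'.1 hf
  rw [map_sum]
  exact Finset.sum_eq_zero fun i _ => homogeneousComponent_mul_of_lt (hG _ (g i).2) ht _

lemma gradedPiece_span_eq_bot (hG : ∀ g ∈ G, g.IsHomogeneous a) {t : ℕ} (ht : t < a) :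
    gradedPiece (Ideal.span G) t = ⊥ := by
  rw [eq_bot_iff]
  intro f hf
  have : homogeneousComponent t (f : CoordRing K N) = 0 :=
    homogeneousComponent_eq_zero_of_mem_span hG hf ht
  rw [homogeneousComponent_of_mem f.2, if_pos rfl] at this
  exact Subtype.ext this

theorem hasInitialDegree_span (hG : ∀ g ∈ G, g.IsHomogeneous a) {g : CoordRing K N} (hg : g ∈ G)
    (hg0 : g ≠ 0) : HasInitialDegree (Ideal.span G) a := by
  constructor
  · rw [Set.mem_ofPred_eq, Submodule.ne_bot_iff]
    exact ⟨⟨g, hG g hg⟩, Ideal.subset_span hg, fun h => hg0 (congrArg Subtype.val h)⟩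
  · intro t ht
    by_contra! hlt
    exact ht (gradedPiece_span_eq_bot hG hlt)

/-- The minimal homogeneous generators of an ideal generated in degree `a` have degree `a`. -/
theorem IsMinimalHomogeneousGenerators.isHomogeneous (hG : ∀ g ∈ G, g.IsHomogeneous a)
    {S : Set (CoordRing K N)} (hS : IsMinimalHomogeneousGenerators (Ideal.span G) S)
    {f : CoordRing K N} (hf : f ∈ S) : f.IsHomogeneous a := by
  obtain ⟨hhom, hspan, hmin⟩ := hS
  by_contra hfa
  -- The members of degree a already generate: in the degree a component of an expression for g ∈ G,
  -- those of lower degree vanish and those of higher degree do not contribute.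
  refine hmin {g ∈ S | g.IsHomogeneous a} ⟨Set.sep_subset _ _, fun h => hfa (h hf).2⟩ ?_
  refine le_antisymm ((Ideal.span_mono (Set.sep_subset _ _)).trans hspan.le) (Ideal.span_le.2 ?_)
  intro g hg
  have hgS : g ∈ Ideal.span S := hspan ▸ Ideal.subset_span hg
  obtain ⟨n, r, x, hx⟩ := Submodule.mem_span_set'.1 hgS
  have hga : homogeneousComponent a g = g := by
    rw [homogeneousComponent_of_mem (hG g hg), if_pos rfl]
  rw [SetLike.mem_coe, ← hga, ← hx, map_sum]
  refine Ideal.sum_mem _ fun i _ => ?_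
  obtain ⟨d, hd⟩ := hhom _ (x i).2
  rcases lt_trichotomy d a with hlt | rfl | hlt
  · have h0 : ((x i : S) : CoordRing K N) = 0 := by
      have := homogeneousComponent_eq_zero_of_mem_span hG
        (hspan ▸ Ideal.subset_span (x i).2 : ((x i : S) : CoordRing K N) ∈ Ideal.span G) hlt
      rwa [homogeneousComponent_of_mem hd, if_pos rfl] at this
    rw [h0, smul_zero, map_zero]
    exact zero_mem _
  · rw [smul_eq_mul, homogeneousComponent_mul_of_le hd le_rfl]
    exact Ideal.mul_mem_left _ _ (Ideal.subset_span ⟨(x i).2, hd⟩)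
  · rw [smul_eq_mul, homogeneousComponent_mul_of_lt hd hlt]
    exact zero_mem _

end Generators

end PseudoStar

end

open scoped LinearAlgebra.Projectivization

noncomputable section

namespace PseudoStar

open MvPolynomial Module

variable {K : Type*} [Field K] {N s c : ℕ}

/-! ### The vanishing ideal of the configuration -/

section Configuration

variable {H : Fin s → Flat K N} {φ : Fin s → Dual K (Fin (N + 1) → K)}

/-- A hyperplane is the zero locus of a nonzero functional. -/
lemma IsHyperplane.exists_ker_eq {L : Flat K N} (hL : IsHyperplane L) :
    ∃ w : Dual K (Fin (N + 1) → K), w ≠ 0 ∧ L.submodule = LinearMap.ker w := by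
  have hL' : finrank K L.submodule + 1 = N + 1 := hL
  have hfin : finrank K (Fin (N + 1) → K) = N + 1 := by simp
  have hlt : L.submodule < ⊤ := by
    rw [lt_top_iff_ne_top]
    intro h
    rw [h, finrank_top, hfin] at hL'
    omega
  obtain ⟨w, hw, hle⟩ := Submodule.exists_le_ker_of_lt_top _ hlt
  refine ⟨w, hw, Submodule.eq_of_le_of_finrank_eq hle ?_⟩
  have := Module.Dual.finrank_ker_add_one_of_ne_zero hw
  omega

lemma submodule_iInf_eq (hφ : ∀ i, (H i).submodule = LinearMap.ker (φ i)) (T : Finset (Fin s)) :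
    (⨅ i ∈ T, H i : Flat K N).submodule = (Submodule.span K (φ '' T)).dualCoannihilator := by
  simp only [OrderIso.map_iInf, hφ]
  ext v
  simp only [Submodule.mem_iInf, LinearMap.mem_ker, Submodule.mem_dualCoannihilator]
  constructor
  · intro h w hw
    induction hw using Submodule.span_induction with
    | mem x hx =>
      obtain ⟨i, hi, rfl⟩ := hx
      exact h i hi
    | zero => rfl
    | add x y _ _ hx hy => rw [LinearMap.add_apply, hx, hy, add_zero]
    | smul a x _ hx => rw [LinearMap.smul_apply, hx, smul_zero]
  · exact fun h i hi => h _ (Submodule.subset_span ⟨i, hi, rfl⟩)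

lemma mem_configuration_iff (hφ : ∀ i, (H i).submodule = LinearMap.ker (φ i))
    {v : Fin (N + 1) → K} (hv : v ≠ 0) : Projectivization.mk K v hv ∈ configuration c H ↔
      ∃ T : Finset (Fin s), T.card = c ∧ ∀ i ∈ T, φ i v = 0 := by
  simp only [configuration, Set.mem_iUnion, SetLike.mem_coe, exists_prop]
  refine exists_congr fun T => and_congr_right fun _ => ?_
  rw [← Projectivization.Subspace.mem_submodule_iff]
  simp [hφ, Submodule.mem_iInf]

lemma linearIndepOn_of_hasCodim (hφ : ∀ i, (H i).submodule = LinearMap.ker (φ i))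
    {T : Finset (Fin s)} (hT : HasCodim (⨅ i ∈ T, H i) T.card) : LinearIndepOn K φ T := by
  rw [HasCodim, submodule_iInf_eq hφ] at hT
  have h := Subspace.finrank_add_finrank_dualCoannihilator_eq (Submodule.span K (φ '' T))
  have hfin : finrank K (Fin (N + 1) → K) = N + 1 := by simp
  have himg : Set.range (fun i : T => φ i) = φ '' T := by
    ext; simp
  have : LinearIndependent K fun i : T => φ i := by
    rw [linearIndependent_iff_card_eq_finrank_span, Set.finrank, himg, Fintype.card_coe]
    omega
  exact this

/-- A form vanishing on the linear space of F restricts to a polynomial in θ that is zero at all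
points, hence zero as K is infinite. Conversely the products generating the intersection vanish on
the configuration, any s - c + 1 indices meeting any c of them. -/
lemma IsStarFamily.vanishingIdeal_eq [Infinite K] {d : ℕ} (hd : 1 ≤ d) (hcs : c ≤ s)
    {θ : Fin d → Dual K (Fin (N + 1) → K)}
    (hφ : ∀ i, (H i).submodule = LinearMap.ker (φ i))
    (hb : ∀ F : Finset (Fin s), F.card = c →
      ∃ b : Basis (F ⊕ Fin d) K (Dual K (Fin (N + 1) → K)),
        (∀ i : F, b (.inl i) = φ i) ∧ ∀ j, b (.inr j) = θ j)
    (hℓ : IsStarFamily (fun i => linearForm (φ i)) c) :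
    vanishingIdeal (configuration c H) =
      ⨅ (F : Finset (Fin s)) (_ : F.card = c), formIdeal (fun i => linearForm (φ i)) F := by
  classical
  apply le_antisymm
  · refine Ideal.span_le.2 ?_
    rintro f ⟨⟨n, hn⟩, hf⟩
    simp only [SetLike.mem_coe, Ideal.mem_iInf]
    intro F hF
    obtain ⟨b, hbφ, hbθ⟩ := hb F hF
    rw [← projHom_eq_zero_iff b hbφ]
    have hne : ∀ z : Fin d → K, z ≠ 0 → eval z (projHom b f) = 0 := by
      intro z hz
      obtain ⟨v, hv, hvθ, hvf⟩ := exists_point b hbφ hbθ z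
      have hv0 : v ≠ 0 := by
        rintro rfl
        exact hz (funext fun j => by rw [← hvθ, map_zero, Pi.zero_apply])
      rw [← hvf]
      exact hf v hv0 ((mem_configuration_iff hφ hv0).2 ⟨F, hF, hv⟩)
    refine MvPolynomial.funext fun z => ?_
    rw [map_zero]
    -- The origin is not a projective point. There a form of positive degree vanishes, and a
    -- constant is determined by its value at a nonzero point, which exists since d ≥ 1.
    by_cases hz : z = 0
    · have hhom := isHomogeneous_projHom b hn
      have h1 := hne (fun _ => 1) fun h => one_ne_zero (congrFun h ⟨0, hd⟩)
      rcases Nat.eq_zero_or_pos n with rfl | hpos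
      · obtain ⟨a, ha⟩ : ∃ a, projHom b f = C a :=
          ⟨_, totalDegree_eq_zero_iff_eq_C.1 (Nat.le_zero.1 hhom.totalDegree_le)⟩
        rw [ha, eval_C] at h1 ⊢
        exact h1
      · rw [hz, eval_zero, constantCoeff_eq]
        exact hhom.coeff_eq_zero (by rw [map_zero]; exact hpos.ne)
    · exact hne z hz
  · rw [hℓ.iInf_formIdeal_eq_span hcs]
    refine Ideal.span_mono ?_
    rintro _ ⟨D, hD, rfl⟩
    have hD' : D.card = s - c + 1 := hD
    refine ⟨⟨_, IsHomogeneous.prod D _ _ fun i _ => isHomogeneous_linearForm (φ i)⟩, ?_⟩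
    intro v hv hmem
    obtain ⟨T, hT, hTv⟩ := (mem_configuration_iff hφ hv).1 hmem
    obtain ⟨i, hi⟩ : (D ∩ T).Nonempty := by
      rw [Finset.nonempty_iff_ne_empty]
      intro h
      have h1 := Finset.card_union_add_card_inter D T
      have h2 := Finset.card_le_univ (D ∪ T)
      rw [h, Finset.card_empty] at h1
      rw [Fintype.card_fin] at h2
      omega
    rw [Finset.mem_inter] at hi
    rw [map_prod]
    refine Finset.prod_eq_zero hi.1 ?_
    rw [eval_linearForm, hTv i hi.2]

/-- The statement on pseudo-star configurations for hyperplanes given by functionals, `c` of which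
are independent and independent of any other one of them. -/
theorem configuration_of_functionals [Infinite K] (hc : 1 ≤ c) (hcN : c ≤ N) (hcs : c ≤ s)
    (hφ : ∀ i, (H i).submodule = LinearMap.ker (φ i)) (hφ0 : ∀ i, φ i ≠ 0)
    (hind : ∀ F : Finset (Fin s), F.card = c → LinearIndepOn K φ F)
    (hspan : ∀ F : Finset (Fin s), F.card = c → ∀ j ∉ F, φ j ∉ Submodule.span K (φ '' F))
    {I : Ideal (CoordRing K N)} (hI : I = vanishingIdeal (configuration c H)) :
    HasDegree I (s.choose c) ∧ IsCMRing (CoordRing K N ⧸ I) ∧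
    (∀ m : ℕ, IsCMRing (CoordRing K N ⧸ symbolicPower I m)) ∧
    HasInitialDegree I (s - c + 1) ∧
    (∀ S : Set (CoordRing K N), IsMinimalHomogeneousGenerators I S →
      ∀ f ∈ S, f.IsHomogeneous (s - c + 1)) := by
  have hd : (N - c + 1) + c = finrank K (Dual K (Fin (N + 1) → K)) := by
    rw [Subspace.dual_finrank_eq, finrank_fin_fun]
    omega
  obtain ⟨θ, hb⟩ := exists_common_basis hind hd
  have hℓ := isStarFamily_linearForm hb hspan
  rw [hℓ.vanishingIdeal_eq (Nat.le_add_left 1 _) hcs hφ hb] at hI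
  have hG : ∀ g ∈ ((fun D : Finset (Fin s) => ∏ i ∈ D, linearForm (φ i)) ''
      {D | D.card = s - c + 1}), g.IsHomogeneous (s - c + 1) := by
    rintro _ ⟨D, hD, rfl⟩
    have hD' : D.card = s - c + 1 := hD
    have := IsHomogeneous.prod D (fun i => linearForm (φ i)) (fun _ => 1)
      fun i _ => isHomogeneous_linearForm (φ i)
    rwa [Finset.sum_const, smul_eq_mul, mul_one, hD'] at this
  refine ⟨?_, ?_, fun m => ?_, ?_, ?_⟩
  · rw [hI]
    refine hℓ.cleanFiltration_choose.hasDegree (D := N - c) ?_ ?_ (Nat.choose_pos hcs).ne'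
    · rintro _ ⟨a, rfl⟩
      refine ⟨_, IsHomogeneous.prod _ _ (fun i => 1 * a i) fun i _ => ?_⟩
      exact (isHomogeneous_linearForm (φ i)).pow (a i)
    · rintro _ ⟨F, hF, rfl⟩ t
      obtain ⟨b, hbφ, -⟩ := hb F hF
      exact hilbertFunction_formIdeal b hbφ t
  · rw [hI]
    exact isCMRing_of_cleanFiltration hb hℓ.cleanFiltration_choose
  · rw [hI, hℓ.symbolicPower_eq]
    obtain ⟨n, hn⟩ := hℓ.exists_cleanFiltration m
    exact isCMRing_of_cleanFiltration hb hn
  · rw [hI, hℓ.iInf_formIdeal_eq_span hcs]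
    obtain ⟨D, -, hD⟩ := Finset.exists_subset_card_eq (s := (Finset.univ : Finset (Fin s)))
      (n := s - c + 1) (by rw [Finset.card_univ, Fintype.card_fin]; omega)
    refine hasInitialDegree_span hG ⟨D, hD, rfl⟩ (Finset.prod_ne_zero_iff.2 fun i _ => ?_)
    rw [Ne, map_eq_zero_iff _ linearForm_injective]
    exact hφ0 i
  · intro S hS f hf
    rw [hI, hℓ.iInf_formIdeal_eq_span hcs] at hS
    exact hS.isHomogeneous hG hf

end Configuration

/-- An intersection of `s` hyperplanes is an intersection of independent ones among them. -/
lemma exists_configuration_eq {H : Fin s → Flat K N} {φ : Fin s → Dual K (Fin (N + 1) → K)}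
    (hφ : ∀ i, (H i).submodule = LinearMap.ker (φ i)) :
    ∃ (r : ℕ) (e : Fin r → Fin s), Function.Injective e ∧ LinearIndependent K (φ ∘ e) ∧
      Submodule.span K (Set.range (φ ∘ e)) = Submodule.span K (Set.range φ) ∧
      configuration r (H ∘ e) = configuration s H := by
  obtain ⟨κ, a, ha, hspan, hli⟩ := exists_linearIndependent' K φ
  have : Finite κ := Finite.of_injective a ha
  obtain ⟨r, ⟨g⟩⟩ := Finite.exists_equiv_fin κ
  have hsp : Submodule.span K (Set.range (φ ∘ a ∘ g.symm)) = Submodule.span K (Set.range φ) := by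
    rw [← hspan, ← Function.comp_assoc, g.symm.surjective.range_comp]
  refine ⟨r, a ∘ g.symm, ha.comp g.symm.injective, hli.comp _ g.symm.injective, hsp, ?_⟩
  -- With as many indices as hyperplanes, the configuration is the intersection of all of them and
  -- depends only on the span of the functionals.
  have huniv : ∀ (n : ℕ) (T : Finset (Fin n)), T.card = n ↔ T = Finset.univ := fun n T => by
    rw [Finset.card_eq_iff_eq_univ (s := T) |>.symm, Fintype.card_fin]
  ext x
  induction x using Projectivization.ind with
  | h v hv =>
  rw [mem_configuration_iff hφ,
    mem_configuration_iff (H := H ∘ a ∘ g.symm) (φ := φ ∘ a ∘ g.symm) (fun i => hφ _)]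
  simp only [huniv, exists_eq_left, Finset.mem_univ, true_imp_iff]
  have key : ∀ {n : ℕ} (ψ : Fin n → Dual K (Fin (N + 1) → K)), (∀ i, ψ i v = 0) ↔
      Submodule.span K (Set.range ψ) ≤ LinearMap.ker (Dual.eval K _ v) := by
    intro n ψ
    rw [Submodule.span_le, Set.range_subset_iff]
    rfl
  rw [key, key, hsp]

end PseudoStar

end
theorem proposition2p5 {K : Type*} [Field K] [CharZero K] (N c s : ℕ)
    (hc : 1 ≤ c) (hcN : c ≤ N) (hcs : c ≤ s)
    (H : Fin s → PseudoStar.Flat K N)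
    (hH : ∀ i, PseudoStar.IsHyperplane (H i))
    (hdistinct : Function.Injective H)
    (hproper : ∀ T : Finset (Fin s), T.card = c + 1 →
      PseudoStar.HasCodim (⨅ i ∈ T, H i) (c + 1))
    (I : Ideal (PseudoStar.CoordRing K N))
    (hI : I = PseudoStar.vanishingIdeal (PseudoStar.configuration c H)) :
    PseudoStar.HasDegree I (s.choose c) ∧
    PseudoStar.IsCMRing (PseudoStar.CoordRing K N ⧸ I) ∧
    (∀ m : ℕ, 1 ≤ m → m ≤ c →
      PseudoStar.IsCMRing (PseudoStar.CoordRing K N ⧸ PseudoStar.symbolicPower I m)) ∧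
    PseudoStar.HasInitialDegree I (s - c + 1) ∧
    (∀ S : Set (PseudoStar.CoordRing K N), PseudoStar.IsMinimalHomogeneousGenerators I S →
      ∀ f ∈ S, f.IsHomogeneous (s - c + 1)) := by
  choose φ hφ0 hφ using fun i => (hH i).exists_ker_eq
  rcases hcs.lt_or_eq with hlt | rfl
  · have hind1 : ∀ T : Finset (Fin s), T.card = c + 1 → LinearIndepOn K φ T := fun T hT =>
      PseudoStar.linearIndepOn_of_hasCodim hφ (hT ▸ hproper T hT)
    have hind : ∀ F : Finset (Fin s), F.card = c → LinearIndepOn K φ F := by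
      intro F hF
      obtain ⟨T, hFT, -, hT⟩ := Finset.exists_subsuperset_card_eq (Finset.subset_univ F)
        (n := c + 1) (by omega) (by rw [Finset.card_univ, Fintype.card_fin]; omega)
      exact (hind1 T hT).mono (Finset.coe_subset.2 hFT)
    have hspan : ∀ F : Finset (Fin s), F.card = c → ∀ j ∉ F,
        φ j ∉ Submodule.span K (φ '' F) := by
      intro F hF j hj
      have h := hind1 (insert j F) (by rw [Finset.card_insert_of_notMem hj, hF])
      rw [Finset.coe_insert, linearIndepOn_insert (Finset.mem_coe.not.2 hj)] at h
      exact h.2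
    obtain ⟨h1, h2, h3, h4, h5⟩ :=
      PseudoStar.configuration_of_functionals hc hcN hcs hφ hφ0 hind hspan hI
    exact ⟨h1, h2, fun m _ _ => h3 m, h4, h5⟩
  -- For s = c there are no c + 1 hyperplanes to compare, so the functionals may be dependent; r
  -- independent ones among them cut out the same linear space.
  · obtain ⟨r, e, he, hli, hsp, hconf⟩ := PseudoStar.exists_configuration_eq hφ
    have hr : 1 ≤ r := by
      by_contra! hr0
      obtain rfl : r = 0 := by omega
      rw [Set.range_eq_empty, Submodule.span_empty, eq_comm, Submodule.span_eq_bot] at hsp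
      exact hφ0 ⟨0, hc⟩ (hsp _ ⟨_, rfl⟩)
    have hrc : r ≤ c := by
      simpa using Fintype.card_le_of_injective e he
    rw [← hconf] at hI
    obtain ⟨h1, h2, h3, h4, h5⟩ := PseudoStar.configuration_of_functionals (φ := φ ∘ e) hr
      (hrc.trans hcN) le_rfl (fun i => hφ _) (fun i => hφ0 _)
      (fun F _ => hli.linearIndepOn F) (fun F hF j hj => by
        have : F = Finset.univ := by
          rw [← Finset.card_eq_iff_eq_univ, hF, Fintype.card_fin]
        exact absurd (this ▸ Finset.mem_univ j) hj) hI
    -- Replacing c by r is harmless: the degree is 1 and the initial degree is 1 for both.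
    rw [Nat.choose_self] at h1 ⊢
    rw [Nat.sub_self] at h4 h5 ⊢
    exact ⟨h1, h2, fun m _ _ => h3 m, h4, h5⟩
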